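/- Let $\alpha_1,\alpha_2,\alpha_3\in\mathbb R^2$ be the vertices of a closed triangle $T$ with non-empty interior. For $ij\in\{12,23,31\}$ let $\ell_{ij}=|\alpha_i-\alpha_j|$, and use Cartesian coordinates $(s,t)$ with origin $\alpha_i$, $s$-axis directed from $\alpha_i$ to $\alpha_j$, and $t$-axis directed along the normal to $\overline{\alpha_i\alpha_j}$ pointing into $T$. A function $\varphi$ of bounded variation on $[0,\ell_{ij}]$ is extended by $0$ outside $[0,\ell_{ij}]$ (so $\varphi(0_-)=\varphi(\ell_{ij+})=0$) and is represented by $\varphi(s)=\max\{\varphi(s_-),\varphi(s_+)\}$ for $s\in[0,\ell_{ij}]$; its generalized graph over $\overline{\alpha_i\alpha_j}$ is the set of points with coordinates $(s,\theta\varphi(s_-)+(1-\theta)\varphi(s_+))$, $s\in[0,\ell_{ij}]$, $\theta\in[0,1]$. A BV graph-type connection is a triple $\Gamma=(\Gamma_1,\Gamma_2,\Gamma_3)$ of subsets of $T$ with $\alpha_i\in\Gamma_i$ for $i=1,2,3$, such that $\Gamma_1\cap\Gamma_2=\Gamma_2\cap\Gamma_3=\Gamma_3\cap\Gamma_1=\{p\}$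 for some point $p\in T$ (the target triple point), and such that for each $ij\in\{12,23,31\}$ the set $\Gamma_i\cup\Gamma_j$ is the generalized graph over $\overline{\alpha_i\alpha_j}$ of a function of bounded variation, denoted $\varphi_{ij}(\Gamma)$ (it is unique). Let $X$ be the set of all BV graph-type connections; say that $\Gamma^n\to\Gamma$ in $X$ if $\varphi_{ij}(\Gamma^n)\to\varphi_{ij}(\Gamma)$ in $L^1([0,\ell_{ij}])$ for all $ij\in\{12,23,31\}$. **Theorem (Compactness).** Every sequence $(\Gamma^n)_n$ in $X$ has a subsequence that converges in $X$ to some $\Gamma\in X$. -/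

import Mathlib

open MeasureTheory Filter Topology

/-- The target plane `ℝ²` with its Euclidean structure. -/
abbrev TargetPlane : Type := EuclideanSpace ℝ (Fin 2)

noncomputable section

/-- The closed triangle `T` with vertices `α 0, α 1, α 2`. -/
def targetTriangle (α : Fin 3 → TargetPlane) : Set TargetPlane :=
  convexHull ℝ (Set.range α)

/-- The length of the `i`-th side, joining `α i` to `α (i + 1)`. Addition in `Fin 3` is cyclic, so
`i = 0, 1, 2` are the sides `12`, `23`, `31`, in this order and with these orientations. -/
def sideLength (α : Fin 3 → TargetPlane) (i : Fin 3) : ℝ := ‖α (i + 1) - α i‖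

/-- The unit vector pointing from `α i` to `α (i + 1)`. -/
def sideDir (α : Fin 3 → TargetPlane) (i : Fin 3) : TargetPlane :=
  (sideLength α i)⁻¹ • (α (i + 1) - α i)

/-- The altitude vector on the `i`-th side: the component, orthogonal to that side, of the vector
pointing from `α i` to the opposite vertex `α (i + 2)`. -/
def sideAltitude (α : Fin 3 → TargetPlane) (i : Fin 3) : TargetPlane :=
  (α (i + 2) - α i) - inner ℝ (sideDir α i) (α (i + 2) - α i) • sideDir α i

/-- The unit normal to the `i`-th side pointing into the triangle. -/
def sideNormal (α : Fin 3 → TargetPlane) (i : Fin 3) : TargetPlane :=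
  ‖sideAltitude α i‖⁻¹ • sideAltitude α i

/-- The point with coordinates `(s, t)` in the Cartesian system with origin `α i`, whose `s`-axis
is the oriented line through the `i`-th side and whose `t`-axis points into the triangle. -/
def sidePoint (α : Fin 3 → TargetPlane) (i : Fin 3) (x : ℝ × ℝ) : TargetPlane :=
  α i + x.1 • sideDir α i + x.2 • sideNormal α i

/-- `φ` is a function of bounded variation on `[0, ℓ]`, with the usual conventions: it is extended
by `0` outside `[0, ℓ]` (so that `φ(0₋) = φ(ℓ₊) = 0`), and it is the good representative
`φ = φ₊ = max {φ(s₋), φ(s₊)}` of its `L¹` class. -/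
structure IsGoodBV (ℓ : ℝ) (φ : ℝ → ℝ) : Prop where
  boundedVariation : BoundedVariationOn φ (Set.Icc 0 ℓ)
  zero_outside : ∀ s ∉ Set.Icc 0 ℓ, φ s = 0
  eq_max : ∀ s ∈ Set.Icc 0 ℓ, φ s = max (Function.leftLim φ s) (Function.rightLim φ s)

/-- The generalized graph of `φ` over the closed interval `[0, ℓ]`: all points
`(s, θ φ(s₋) + (1 - θ) φ(s₊))` with `s ∈ [0, ℓ]` and `θ ∈ [0, 1]`. For functions vanishing outside
`[0, ℓ]` it contains `(0, 0)` and `(ℓ, 0)`, possibly with vertical parts over `0` and `ℓ`. -/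
def generalizedGraph (ℓ : ℝ) (φ : ℝ → ℝ) : Set (ℝ × ℝ) :=
  {x | x.1 ∈ Set.Icc 0 ℓ ∧ x.2 ∈ segment ℝ (Function.leftLim φ x.1) (Function.rightLim φ x.1)}

/-- `S` is the generalized graph of the BV function `φ` over the `i`-th side of the triangle. -/
def IsBVGraphOver (α : Fin 3 → TargetPlane) (i : Fin 3) (φ : ℝ → ℝ) (S : Set TargetPlane) : Prop :=
  IsGoodBV (sideLength α i) φ ∧ S = sidePoint α i '' generalizedGraph (sideLength α i) φ

/-- A BV graph-type connection in the triangle with vertices `α`; this type is the space `X`. -/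
structure BVConnection (α : Fin 3 → TargetPlane) where
  /-- the three sets `Γ₁, Γ₂, Γ₃` -/
  branch : Fin 3 → Set TargetPlane
  branch_subset : ∀ i, branch i ⊆ targetTriangle α
  /-- the three pairwise intersections are the same single point, the target triple point -/
  exists_triplePoint : ∃ p ∈ targetTriangle α, ∀ i, branch i ∩ branch (i + 1) = {p}
  vertex_mem : ∀ i, α i ∈ branch i
  /-- graphicality: `Γᵢⱼ = Γᵢ ∪ Γⱼ` is the generalized graph of a BV function over the side `ij` -/
  exists_graph : ∀ i, ∃ φ, IsBVGraphOver α i φ (branch i ∪ branch (i + 1))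

/-- The function `φᵢⱼ(Γᵢⱼ)` whose generalized graph over the side `ij` is `Γᵢ ∪ Γⱼ`. It is unique,
see `IsBVGraphOver.unique`. -/
def BVConnection.graphFun {α : Fin 3 → TargetPlane} (Γ : BVConnection α) (i : Fin 3) : ℝ → ℝ :=
  (Γ.exists_graph i).choose

/-- Convergence in `X`: `φᵢⱼ(Γⁿᵢⱼ) → φᵢⱼ(Γᵢⱼ)` in `L¹([0, ℓᵢⱼ])` for `ij ∈ {12, 23, 31}`. -/
def ConvergesInX {α : Fin 3 → TargetPlane} (Γn : ℕ → BVConnection α) (Γ : BVConnection α) : Prop :=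
  ∀ i, Tendsto
    (fun n => eLpNorm ((Γn n).graphFun i - Γ.graphFun i) 1
      (volume.restrict (Set.Icc 0 (sideLength α i))))
    atTop (𝓝 0)

theorem BVConnection.graphFun_spec {α : Fin 3 → TargetPlane} (Γ : BVConnection α) (i : Fin 3) :
    IsBVGraphOver α i (Γ.graphFun i) (Γ.branch i ∪ Γ.branch (i + 1)) :=
  (Γ.exists_graph i).choose_spec

theorem sideLength_pos {α : Fin 3 → TargetPlane} (hα : AffineIndependent ℝ α) (i : Fin 3) :
    0 < sideLength α i := by
  have h : i + 1 ≠ i := by fin_cases i <;> decide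
  exact norm_pos_iff.2 (sub_ne_zero.2 fun e => h (hα.injective e))

theorem inner_sideDir_self {α : Fin 3 → TargetPlane} (hα : AffineIndependent ℝ α) (i : Fin 3) :
    inner ℝ (sideDir α i) (sideDir α i) = 1 := by
  have h := sideLength_pos hα i
  rw [real_inner_self_eq_norm_sq, sideDir, norm_smul, norm_inv, Real.norm_of_nonneg h.le]
  change ((sideLength α i)⁻¹ * sideLength α i) ^ 2 = 1
  rw [inv_mul_cancel₀ h.ne', one_pow]

theorem sideAltitude_ne_zero {α : Fin 3 → TargetPlane} (hα : AffineIndependent ℝ α) (i : Fin 3) :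
    sideAltitude α i ≠ 0 := by
  intro h0
  have h := sideLength_pos hα i
  rw [affineIndependent_iff_not_collinear] at hα
  apply hα
  rw [collinear_iff_of_mem (Set.mem_range_self i)]
  refine ⟨sideDir α i, ?_⟩
  rintro _ ⟨j, rfl⟩
  have hj : ∀ i j : Fin 3, j = i ∨ j = i + 1 ∨ j = i + 2 := by decide
  rcases hj i j with rfl | rfl | rfl
  · exact ⟨0, by simp⟩
  · refine ⟨sideLength α i, ?_⟩
    rw [sideDir, smul_smul, mul_inv_cancel₀ h.ne', one_smul, vadd_eq_add, sub_add_cancel]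
  · refine ⟨inner ℝ (sideDir α i) (α (i + 2) - α i), ?_⟩
    rw [← sub_eq_zero.1 h0, vadd_eq_add, sub_add_cancel]

theorem inner_sideDir_sideNormal {α : Fin 3 → TargetPlane} (hα : AffineIndependent ℝ α)
    (i : Fin 3) : inner ℝ (sideDir α i) (sideNormal α i) = 0 := by
  have h : inner ℝ (sideDir α i) (sideAltitude α i) = 0 := by
    rw [sideAltitude, inner_sub_right _ (α (i + 2) - α i), inner_smul_right,
      inner_sideDir_self hα, mul_one, sub_self]
  rw [sideNormal, inner_smul_right, h, mul_zero]

theorem inner_sideNormal_self {α : Fin 3 → TargetPlane} (hα : AffineIndependent ℝ α) (i : Fin 3) :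
    inner ℝ (sideNormal α i) (sideNormal α i) = 1 := by
  have h := norm_pos_iff.2 (sideAltitude_ne_zero hα i)
  rw [real_inner_self_eq_norm_sq, sideNormal, norm_smul, norm_inv, norm_norm,
    inv_mul_cancel₀ h.ne', one_pow]

theorem sidePoint_injective {α : Fin 3 → TargetPlane} (hα : AffineIndependent ℝ α) (i : Fin 3) :
    Function.Injective (sidePoint α i) := by
  rintro ⟨s, t⟩ ⟨s', t'⟩ h
  have hc := inner_sideDir_sideNormal hα i
  have hc' : inner ℝ (sideNormal α i) (sideDir α i) = 0 := by rw [real_inner_comm]; exact hc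
  have h1 := congrArg (fun x => inner ℝ (sideDir α i) (x - α i)) h
  have h2 := congrArg (fun x => inner ℝ (sideNormal α i) (x - α i)) h
  simp only [sidePoint, add_assoc, add_sub_cancel_left, inner_add_right, inner_smul_right,
    inner_sideDir_self hα, inner_sideNormal_self hα, hc, hc', mul_one, mul_zero, add_zero,
    zero_add] at h1 h2
  rw [h1, h2]

/-- The function whose generalized graph over a side is a given set is unique. -/
theorem IsBVGraphOver.unique {α : Fin 3 → TargetPlane} (hα : AffineIndependent ℝ α) {i : Fin 3}
    {φ ψ : ℝ → ℝ} {S : Set TargetPlane} (hφ : IsBVGraphOver α i φ S)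
    (hψ : IsBVGraphOver α i ψ S) : φ = ψ := by
  have h := (sidePoint_injective hα i).image_injective (hφ.2.symm.trans hψ.2)
  funext s
  by_cases hs : s ∈ Set.Icc 0 (sideLength α i)
  · rw [hφ.1.eq_max s hs, hψ.1.eq_max s hs]
    have key : ∀ t, t ∈ segment ℝ (Function.leftLim φ s) (Function.rightLim φ s) ↔
        t ∈ segment ℝ (Function.leftLim ψ s) (Function.rightLim ψ s) := fun t => by
      have := Set.ext_iff.1 h (s, t)
      simpa only [generalizedGraph, Set.mem_ofPred_eq, hs, true_and] using this
    simp only [segment_eq_uIcc] at key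
    apply le_antisymm
    · exact ((key _).1 ⟨min_le_max, le_rfl⟩).2
    · exact ((key _).2 ⟨min_le_max, le_rfl⟩).2
  · rw [hφ.1.zero_outside s hs, hψ.1.zero_outside s hs]

end

/-! Write `S i` for the coordinate along side `i`. On branch `i`, going from its vertex to the
triple point, `S i` weakly increases and `S (i + 2)` weakly decreases, because the branch lies in
two generalized graphs at once (`BVConnection.isMonotoneTriod`). Hence `S i - S (i + 2)`
parametrizes the branch, as a Lipschitz curve with constants depending only on the triangle; this
takes the place of a bound on the variation. The structure `IsMonotoneTriod` records these
properties in a form that survives limits.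

The compact subsets of the triangle form a compact space, so along a subsequence the branches and
triple points converge, and the limit is again a monotone triod
(`IsMonotoneTriod.of_kuratowskiTendsto`). What may be lost is that branches meet only in `p`: two of
them can share a whisker over the level `S i = S i p`. It is then cut off from both and given to the
third branch, and its far end becomes the new triple point (`exists_move_whisker`). Each union of
two branches changes over at most one level of its side coordinate, which is invisible in `L¹`.

Conversely, two branches of a monotone triod meeting in one point form a path along which `S i` is
monotone and the height is Lipschitz; such a path traces the generalized graph of a BV function
(`exists_isGoodBV_zero`). Thus the corrected limit is a connection. Finally, set convergence gives
pointwise convergence of the functions at all but countably many abscissas, and dominated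
convergence gives `L¹` convergence. -/

section Connectedness

/-! ### Connectedness of pieces of a set. -/

variable {E : Type*} [TopologicalSpace E]

/-- If the closed sets `A` and `B` meet in a single point and their union is preconnected, then `A`
is preconnected. -/
theorem IsPreconnected.left_of_union_of_inter_eq_singleton {A B : Set E} {p : E}
    (hA : IsClosed A) (hB : IsClosed B) (hp : A ∩ B = {p}) (h : IsPreconnected (A ∪ B)) :
    IsPreconnected A := by
  have hpA : p ∈ A ∩ B := hp ▸ Set.mem_singleton p
  -- All of `B` is added to the closed set that contains `p`. If the common point found lies in `B`,
  -- it is `p`, which is in that set anyway.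
  have key : ∀ t t' : Set E, IsClosed t → IsClosed t' → A ⊆ t ∪ t' → (A ∩ t').Nonempty → p ∈ t →
      (A ∩ (t ∩ t')).Nonempty := by
    intro t t' ht ht' hcov hne hpt
    obtain ⟨x, hx, hx1, hx2, hx3⟩ := isPreconnected_closed_iff.1 h ((A ∩ t) ∪ B) (A ∩ t')
      ((hA.inter ht).union hB) (hA.inter ht')
      (by
        rintro x (hx | hx)
        · rcases hcov hx with h1 | h1
          · exact Or.inl (Or.inl ⟨hx, h1⟩)
          · exact Or.inr ⟨hx, h1⟩
        · exact Or.inl (Or.inr hx))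
      ⟨p, Or.inl hpA.1, Or.inr hpA.2⟩ (hne.mono fun x hx => ⟨Or.inl hx.1, hx⟩)
    refine ⟨x, hx2, ?_, hx3⟩
    rcases hx1 with h1 | h1
    · exact h1.2
    · have : x ∈ A ∩ B := ⟨hx2, h1⟩
      rw [hp] at this
      rwa [Set.mem_singleton_iff.1 this]
  rw [isPreconnected_closed_iff]
  intro t t' ht ht' hcov hne hne'
  rcases hcov hpA.1 with hpt | hpt
  · exact key t t' ht ht' hcov hne' hpt
  · rw [Set.inter_comm t]
    exact key t' t ht' ht (by rwa [Set.union_comm]) hne hpt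

/-- A preconnected subset of `A ∪ B` that misses `A ∩ B` and meets `B` does not meet `A`. -/
theorem IsPreconnected.notMem_of_inter_eq_singleton {A B K : Set E} {p x y : E}
    (hK : IsPreconnected K) (hA : IsClosed A) (hB : IsClosed B) (hp : A ∩ B = {p})
    (hKAB : K ⊆ A ∪ B) (hpK : p ∉ K) (hx : x ∈ K) (hy : y ∈ K) (hyB : y ∈ B) : x ∉ A := by
  intro hxA
  obtain ⟨z, hz, hz'⟩ := isPreconnected_closed_iff.1 hK A B hA hB hKAB ⟨x, hx, hxA⟩ ⟨y, hy, hyB⟩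
  rw [hp] at hz'
  exact hpK (Set.mem_singleton_iff.1 hz' ▸ hz)

/-- The part of a compact set lying over an interval is preconnected if the fibres over the points
of the interval are nonempty and preconnected. -/
theorem IsCompact.isPreconnected_inter_preimage_Icc [T2Space E] {K : Set E} (hK : IsCompact K)
    {f : E → ℝ} (hf : Continuous f) {c d : ℝ}
    (hne : ∀ s ∈ Set.Icc c d, (K ∩ f ⁻¹' {s}).Nonempty)
    (hconn : ∀ s ∈ Set.Icc c d, IsPreconnected (K ∩ f ⁻¹' {s})) :
    IsPreconnected (K ∩ f ⁻¹' Set.Icc c d) := by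
  have hK' : IsCompact (K ∩ f ⁻¹' Set.Icc c d) := hK.inter_right (isClosed_Icc.preimage hf)
  rw [isPreconnected_closed_iff]
  intro t t' ht ht' hcov hn hn'
  have hcl : ∀ t : Set E, IsClosed t → IsClosed (f '' (K ∩ f ⁻¹' Set.Icc c d ∩ t)) := fun t ht =>
    ((hK'.inter_right ht).image hf).isClosed
  -- The images of the two closed pieces cover the interval, so some single fibre meets both;
  -- connectedness of that fibre finishes.
  obtain ⟨s, hs, ⟨x, hx, rfl⟩, ⟨y, hy, hxy⟩⟩ := isPreconnected_closed_iff.1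
    (isPreconnected_Icc (a := c) (b := d)) _ _ (hcl t ht) (hcl t' ht')
    (by
      intro s hs
      obtain ⟨x, hx, rfl⟩ := hne s hs
      rcases hcov ⟨hx, hs⟩ with h | h
      · exact Or.inl ⟨x, ⟨⟨hx, hs⟩, h⟩, rfl⟩
      · exact Or.inr ⟨x, ⟨⟨hx, hs⟩, h⟩, rfl⟩)
    (by
      obtain ⟨x, hx⟩ := hn
      exact ⟨f x, hx.1.2, x, hx, rfl⟩)
    (by
      obtain ⟨x, hx⟩ := hn'
      exact ⟨f x, hx.1.2, x, hx, rfl⟩)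
  obtain ⟨z, hz, hz'⟩ := isPreconnected_closed_iff.1 (hconn _ hs) t t' ht ht'
    (fun z hz => hcov ⟨hz.1, by
      have : f z = f x := hz.2
      rw [Set.mem_preimage, this]; exact hs⟩)
    ⟨x, ⟨hx.1.1, rfl⟩, hx.2⟩ ⟨y, ⟨hy.1.1, hxy⟩, hy.2⟩
  refine ⟨z, ⟨hz.1, ?_⟩, hz'⟩
  have : f z = f x := hz.2
  rw [Set.mem_preimage, this]
  exact hs

end Connectedness

/-! ### One-sided limits of BV functions and closedness of generalized graphs. -/

namespace IsGoodBV

variable {ℓ : ℝ} {φ : ℝ → ℝ}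

/-- On its interval, a good BV function is a difference of two monotone functions. -/
theorem exists_monotone_sub (h : IsGoodBV ℓ φ) :
    ∃ f g : ℝ → ℝ, Monotone f ∧ Monotone g ∧ ∀ s ∈ Set.Icc 0 ℓ, φ s = f s - g s := by
  obtain ⟨f, g, hf, hg, hfg⟩ :=
    h.boundedVariation.locallyBoundedVariationOn.exists_monotoneOn_sub_monotoneOn
  have hb : ∀ {f : ℝ → ℝ}, MonotoneOn f (Set.Icc 0 ℓ) →
      BddBelow (f '' Set.Icc 0 ℓ) ∧ BddAbove (f '' Set.Icc 0 ℓ) := fun {f} hf =>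
    ⟨⟨f 0, by
      rintro _ ⟨x, hx, rfl⟩
      exact hf ⟨le_rfl, hx.1.trans hx.2⟩ hx hx.1⟩, ⟨f ℓ, by
      rintro _ ⟨x, hx, rfl⟩
      exact hf hx ⟨hx.1.trans hx.2, le_rfl⟩ hx.2⟩⟩
  obtain ⟨f', hf', hff'⟩ := hf.exists_monotone_extension (hb hf).1 (hb hf).2
  obtain ⟨g', hg', hgg'⟩ := hg.exists_monotone_extension (hb hg).1 (hb hg).2
  refine ⟨f', g', hf', hg', fun s hs => ?_⟩
  rw [← hff' hs, ← hgg' hs, hfg]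
  rfl

theorem measurable (h : IsGoodBV ℓ φ) : Measurable φ := by
  obtain ⟨f, g, hf, hg, hfg⟩ := h.exists_monotone_sub
  have : φ = (Set.Icc 0 ℓ).indicator (fun s => f s - g s) := by
    funext s
    by_cases hs : s ∈ Set.Icc 0 ℓ
    · rw [Set.indicator_of_mem hs, hfg s hs]
    · rw [Set.indicator_of_notMem hs, h.zero_outside s hs]
  rw [this]
  exact (hf.measurable.sub hg.measurable).indicator measurableSet_Icc

theorem tendsto_leftLim (h : IsGoodBV ℓ φ) (s : ℝ) :
    Tendsto φ (𝓝[<] s) (𝓝 (Function.leftLim φ s)) := by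
  apply tendsto_leftLim_of_tendsto
  obtain ⟨f, g, hf, hg, hfg⟩ := h.exists_monotone_sub
  by_cases hs : 0 < s ∧ s ≤ ℓ
  · refine ⟨_, ((hf.tendsto_leftLim s).sub (hg.tendsto_leftLim s)).congr' ?_⟩
    filter_upwards [Ioo_mem_nhdsLT hs.1] with r hr
    exact (hfg r ⟨hr.1.le, hr.2.le.trans hs.2⟩).symm
  · refine ⟨0, tendsto_const_nhds.congr' ?_⟩
    rcases not_and_or.1 hs with h0 | h0
    · filter_upwards [self_mem_nhdsWithin] with r hr
      exact (h.zero_outside r fun hr' => h0 (hr'.1.trans_lt hr)).symm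
    · filter_upwards [Ioo_mem_nhdsLT (not_le.1 h0)] with r hr
      exact (h.zero_outside r fun hr' => not_lt.2 hr'.2 hr.1).symm

theorem tendsto_rightLim (h : IsGoodBV ℓ φ) (s : ℝ) :
    Tendsto φ (𝓝[>] s) (𝓝 (Function.rightLim φ s)) := by
  apply tendsto_rightLim_of_tendsto
  obtain ⟨f, g, hf, hg, hfg⟩ := h.exists_monotone_sub
  by_cases hs : 0 ≤ s ∧ s < ℓ
  · refine ⟨_, ((hf.tendsto_rightLim s).sub (hg.tendsto_rightLim s)).congr' ?_⟩
    filter_upwards [Ioo_mem_nhdsGT hs.2] with r hr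
    exact (hfg r ⟨hs.1.trans hr.1.le, hr.2.le⟩).symm
  · refine ⟨0, tendsto_const_nhds.congr' ?_⟩
    rcases not_and_or.1 hs with h0 | h0
    · filter_upwards [Ioo_mem_nhdsGT (not_le.1 h0)] with r hr
      exact (h.zero_outside r fun hr' => not_lt.2 hr'.1 hr.2).symm
    · filter_upwards [self_mem_nhdsWithin] with r hr
      exact (h.zero_outside r fun hr' => h0 ((show s < r from hr).trans_le hr'.2)).symm

/-- The one-sided limits of a good BV function agree outside a countable set. -/
theorem countable_leftLim_ne_rightLim (h : IsGoodBV ℓ φ) :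
    {s | Function.leftLim φ s ≠ Function.rightLim φ s}.Countable := by
  obtain ⟨f, g, hf, hg, hfg⟩ := h.exists_monotone_sub
  refine ((hf.countable_not_continuousAt.union hg.countable_not_continuousAt).union
    (Set.toFinite {0, ℓ}).countable).mono fun s hs => ?_
  by_contra hcon
  simp only [Set.mem_union, Set.mem_ofPred_eq, not_or, not_not, Set.mem_insert_iff,
    Set.mem_singleton_iff] at hcon
  obtain ⟨⟨hfs, hgs⟩, h0, hℓ⟩ := hcon
  apply hs
  have hcont : ContinuousAt φ s := by
    by_cases hs' : s ∈ Set.Icc 0 ℓ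
    · have hs'' : s ∈ Set.Ioo 0 ℓ := ⟨lt_of_le_of_ne hs'.1 (Ne.symm h0), lt_of_le_of_ne hs'.2 hℓ⟩
      refine (hfs.sub hgs).congr ?_
      filter_upwards [Ioo_mem_nhds hs''.1 hs''.2] with r hr
      exact (hfg r (Set.Ioo_subset_Icc_self hr)).symm
    · refine (continuousAt_const (y := (0 : ℝ))).congr ?_
      filter_upwards [isClosed_Icc.isOpen_compl.mem_nhds hs'] with r hr
      exact (h.zero_outside r hr).symm
  rw [leftLim_eq_of_tendsto (hcont.tendsto.mono_left nhdsWithin_le_nhds),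
    rightLim_eq_of_tendsto (hcont.tendsto.mono_left nhdsWithin_le_nhds)]

/-- Near `s` both one-sided limits stay within `ε / 2` of the interval between the one-sided limits
at `s`, so a point at distance at least `ε` from that vertical segment has a neighbourhood free of
the graph. -/
theorem isClosed_generalizedGraph (h : IsGoodBV ℓ φ) : IsClosed (generalizedGraph ℓ φ) := by
  rw [← isOpen_compl_iff, isOpen_iff_mem_nhds]
  rintro ⟨s, t⟩ hst
  by_cases hs : s ∈ Set.Icc 0 ℓ
  · have ht : t ∉ Set.uIcc (Function.leftLim φ s) (Function.rightLim φ s) := fun ht =>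
      hst ⟨hs, by rwa [segment_eq_uIcc]⟩
    obtain ⟨ε, hε, hball⟩ := Metric.isOpen_iff.1
      (isCompact_uIcc.isClosed.isOpen_compl : IsOpen
        (Set.uIcc (Function.leftLim φ s) (Function.rightLim φ s))ᶜ) t ht
    set m := min (Function.leftLim φ s) (Function.rightLim φ s) with hm
    set M := max (Function.leftLim φ s) (Function.rightLim φ s) with hM
    have hIcc : ∀ x ∈ Set.Icc m M, Set.Icc (m - ε / 2) (M + ε / 2) ∈ 𝓝 x := fun x hx =>
      Icc_mem_nhds (by linarith [hx.1]) (by linarith [hx.2])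
    have hl0 := hIcc _ ⟨min_le_left _ _, le_max_left _ _⟩
    have hr0 := hIcc _ ⟨min_le_right _ _, le_max_right _ _⟩
    have hl : ∀ᶠ r in 𝓝[<] s, φ r ∈ Set.Icc (m - ε / 2) (M + ε / 2) := h.tendsto_leftLim s hl0
    have hr : ∀ᶠ r in 𝓝[>] s, φ r ∈ Set.Icc (m - ε / 2) (M + ε / 2) := h.tendsto_rightLim s hr0
    have hev : ∀ᶠ r in 𝓝 s, Function.leftLim φ r ∈ Set.Icc (m - ε / 2) (M + ε / 2) ∧
        Function.rightLim φ r ∈ Set.Icc (m - ε / 2) (M + ε / 2) := by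
      obtain ⟨a, ha, hal⟩ := (mem_nhdsLT_iff_exists_Ioo_subset' (sub_one_lt s)).1 hl
      obtain ⟨b, hb, hbr⟩ := (mem_nhdsGT_iff_exists_Ioo_subset' (lt_add_one s)).1 hr
      filter_upwards [Ioo_mem_nhds ha hb] with r hr
      rcases lt_trichotomy r s with hrs | rfl | hrs
      · exact ⟨isClosed_Icc.mem_of_tendsto (h.tendsto_leftLim r)
          (by filter_upwards [Ioo_mem_nhdsLT hr.1] with u hu
              exact hal ⟨hu.1, hu.2.trans hrs⟩),
          isClosed_Icc.mem_of_tendsto (h.tendsto_rightLim r)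
          (by filter_upwards [Ioo_mem_nhdsGT hrs] with u hu
              exact hal ⟨hr.1.trans hu.1, hu.2⟩)⟩
      · exact ⟨mem_of_mem_nhds hl0, mem_of_mem_nhds hr0⟩
      · exact ⟨isClosed_Icc.mem_of_tendsto (h.tendsto_leftLim r)
          (by filter_upwards [Ioo_mem_nhdsLT hrs] with u hu
              exact hbr ⟨hu.1, hu.2.trans hr.2⟩),
          isClosed_Icc.mem_of_tendsto (h.tendsto_rightLim r)
          (by filter_upwards [Ioo_mem_nhdsGT hr.2] with u hu
              exact hbr ⟨hrs.trans hu.1, hu.2⟩)⟩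
    rw [nhds_prod_eq]
    filter_upwards [hev.prod_mk (Metric.ball_mem_nhds t (half_pos hε))] with x hx hxG
    obtain ⟨⟨hx1, hx2⟩, hx3⟩ := hx
    have h1 := hxG.2
    rw [segment_eq_uIcc] at h1
    have h2 : x.2 ∈ Set.Icc (m - ε / 2) (M + ε / 2) := Set.uIcc_subset_Icc hx1 hx2 h1
    have hmM : m ≤ M := min_le_max
    rw [Real.dist_eq, abs_lt] at hx3
    have key : ∀ y, |y - t| < ε → ¬ (m ≤ y ∧ y ≤ M) := fun y hy hmy =>
      hball (show y ∈ Metric.ball t ε by rwa [Metric.mem_ball, Real.dist_eq]) ⟨hmy.1, hmy.2⟩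
    rcases le_or_gt x.2 m with h3 | h3
    · exact key m (abs_lt.2 ⟨by linarith, by linarith [h2.1]⟩) ⟨le_rfl, hmM⟩
    rcases le_or_gt x.2 M with h4 | h4
    · exact key x.2 (abs_lt.2 ⟨by linarith, by linarith⟩) ⟨h3.le, h4⟩
    · exact key M (abs_lt.2 ⟨by linarith [h2.2], by linarith⟩) ⟨hmM, le_rfl⟩
  · filter_upwards [continuous_fst.continuousAt.preimage_mem_nhds
      (isClosed_Icc.isOpen_compl.mem_nhds hs)] with x hx hxG
    exact hx hxG.1

end IsGoodBV

/-! ### Generalized graphs traced by monotone paths. -/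

section MonotonePath

variable {a b ℓ : ℝ} {σ τ : ℝ → ℝ}

/-- A path `(σ, τ)` whose first component is monotone from `0` to `ℓ`, and whose second component
has bounded variation and stays between its first and last values on each fibre of `σ`, traces the
generalized graph of a good BV function. -/
theorem exists_isGoodBV_generalizedGraph_eq_image (hab : a ≤ b)
    (hσ : ContinuousOn σ (Set.Icc a b)) (hσm : MonotoneOn σ (Set.Icc a b))
    (hτ : ContinuousOn τ (Set.Icc a b)) (hτv : BoundedVariationOn τ (Set.Icc a b))
    (hσa : σ a = 0) (hσb : σ b = ℓ) (hτa : τ a = 0) (hτb : τ b = 0)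
    (hbetween : ∀ u ∈ Set.Icc a b, ∀ v ∈ Set.Icc a b, ∀ w ∈ Set.Icc u v, σ u = σ v →
      τ w ∈ Set.uIcc (τ u) (τ v)) :
    ∃ φ, IsGoodBV ℓ φ ∧ generalizedGraph ℓ φ = (fun v => (σ v, τ v)) '' Set.Icc a b := by
  have hℓ : 0 ≤ ℓ := hσa ▸ hσb ▸ hσm ⟨le_rfl, hab⟩ ⟨hab, le_rfl⟩ hab
  -- `l s` and `r s` are the first and last times over `s`; the one-sided limits of `φ` at `s` will
  -- be `τ (l s)` and `τ (r s)`.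
  have hfib : ∀ s ∈ Set.Icc 0 ℓ, ∃ l r, l ∈ Set.Icc a b ∧ r ∈ Set.Icc a b ∧ σ l = s ∧ σ r = s ∧
      ∀ v ∈ Set.Icc a b, σ v = s → v ∈ Set.Icc l r := by
    intro s hs
    have hF : IsCompact (Set.Icc a b ∩ σ ⁻¹' {s}) :=
      isCompact_Icc.of_isClosed_subset
        (hσ.preimage_isClosed_of_isClosed isClosed_Icc isClosed_singleton) Set.inter_subset_left
    have hne : (Set.Icc a b ∩ σ ⁻¹' {s}).Nonempty := by
      obtain ⟨v, hv, hvs⟩ := intermediate_value_Icc hab hσ (by rwa [hσa, hσb])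
      exact ⟨v, hv, hvs⟩
    obtain ⟨l, hl, hl'⟩ := hF.exists_isLeast hne
    obtain ⟨r, hr, hr'⟩ := hF.exists_isGreatest hne
    exact ⟨l, r, hl.1, hr.1, hl.2, hr.2, fun v hv hvs => ⟨hl' ⟨hv, hvs⟩, hr' ⟨hv, hvs⟩⟩⟩
  choose! l r hl hr hσl hσr hlr using hfib
  have hlt : ∀ u ∈ Set.Icc a b, ∀ v ∈ Set.Icc a b, σ u < σ v → u < v := fun u hu v hv huv =>
    lt_of_not_ge fun h => absurd (hσm hv hu h) (not_le.2 huv)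
  -- The time `w s` is whichever end gives the larger value, as the convention for representatives
  -- requires. Either choice makes `w` monotone, so `τ ∘ w` inherits bounded variation from `τ`.
  have hw : ∀ s, ∃ w, (w = l s ∨ w = r s) ∧ τ w = max (τ (l s)) (τ (r s)) := fun s => by
    rcases max_choice (τ (l s)) (τ (r s)) with h | h
    · exact ⟨l s, Or.inl rfl, h.symm⟩
    · exact ⟨r s, Or.inr rfl, h.symm⟩
  choose w hwlr hτw using hw
  have hwI : ∀ s ∈ Set.Icc 0 ℓ, w s ∈ Set.Icc a b := fun s hs => by
    rcases hwlr s with h | h <;> rw [h]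
    exacts [hl s hs, hr s hs]
  have hσw : ∀ s ∈ Set.Icc 0 ℓ, σ (w s) = s := fun s hs => by
    rcases hwlr s with h | h <;> rw [h]
    exacts [hσl s hs, hσr s hs]
  have hwm : MonotoneOn w (Set.Icc 0 ℓ) := by
    intro s hs s' hs' hss'
    rcases hss'.eq_or_lt with rfl | hlt'
    · exact le_rfl
    · exact (hlt _ (hwI s hs) _ (hwI s' hs') (by rwa [hσw s hs, hσw s' hs'])).le
  let φ : ℝ → ℝ := (Set.Icc 0 ℓ).indicator (τ ∘ w)
  have hφ : ∀ s ∈ Set.Icc 0 ℓ, φ s = τ (w s) := fun s hs => Set.indicator_of_mem hs _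
  have hφ0 : ∀ s ∉ Set.Icc 0 ℓ, φ s = 0 := fun s hs => Set.indicator_of_notMem hs _
  have hleft : ∀ s ∈ Set.Icc 0 ℓ, Function.leftLim φ s = τ (l s) := by
    intro s hs
    apply leftLim_eq_of_tendsto
    rcases hs.1.eq_or_lt with rfl | hs0
    -- At the end of the interval the zero extension fixes the outer limit, which agrees with `τ a =
    -- 0`.
    · have : l 0 = a := le_antisymm (hlr 0 hs a ⟨le_rfl, hab⟩ hσa).1 (hl 0 hs).1
      rw [this, hτa]
      refine tendsto_const_nhds.congr' ?_
      filter_upwards [self_mem_nhdsWithin] with u hu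
      exact (hφ0 u fun hu' => not_lt.2 hu'.1 hu).symm
    · have hev : ∀ᶠ u in 𝓝[<] s, u ∈ Set.Ioo 0 s := Ioo_mem_nhdsLT hs0
      have hwt : Tendsto w (𝓝[<] s) (𝓝[Set.Icc a b] (l s)) := by
        refine tendsto_nhdsWithin_iff.2 ⟨?_, ?_⟩
        · refine tendsto_order.2 ⟨fun v hv => ?_, fun v hv => ?_⟩
          · have hal : a < l s := lt_of_le_of_ne (hl s hs).1 fun h => by
              have := hσl s hs
              rw [← h, hσa] at this
              exact hs0.ne this
            have hv' : max v a ∈ Set.Icc a b :=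
              ⟨le_max_right _ _, (max_lt hv hal).le.trans (hl s hs).2⟩
            have hlt' : σ (max v a) < s := lt_of_le_of_ne
              (hσl s hs ▸ hσm hv' (hl s hs) (max_lt hv hal).le)
              fun h => absurd (hlr s hs _ hv' h).1 (not_le.2 (max_lt hv hal))
            filter_upwards [hev, Ioo_mem_nhdsLT hlt'] with u hu hu'
            have huI : u ∈ Set.Icc 0 ℓ := ⟨hu.1.le, hu.2.le.trans hs.2⟩
            exact (le_max_left _ _).trans_lt
              (hlt _ hv' _ (hwI u huI) (by rw [hσw u huI]; exact hu'.1))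
          · filter_upwards [hev] with u hu
            have huI : u ∈ Set.Icc 0 ℓ := ⟨hu.1.le, hu.2.le.trans hs.2⟩
            exact (hlt _ (hwI u huI) _ (hl s hs) (by rw [hσw u huI, hσl s hs]; exact hu.2)).trans hv
        · filter_upwards [hev] with u hu
          exact hwI u ⟨hu.1.le, hu.2.le.trans hs.2⟩
      refine ((hτ (l s) (hl s hs)).tendsto.comp hwt).congr' ?_
      filter_upwards [hev] with u hu
      exact (hφ u ⟨hu.1.le, hu.2.le.trans hs.2⟩).symm
  have hright : ∀ s ∈ Set.Icc 0 ℓ, Function.rightLim φ s = τ (r s) := by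
    intro s hs
    apply rightLim_eq_of_tendsto
    rcases hs.2.eq_or_lt with rfl | hs0
    · have : r s = b := le_antisymm (hr s hs).2 (hlr s hs b ⟨hab, le_rfl⟩ hσb).2
      rw [this, hτb]
      refine tendsto_const_nhds.congr' ?_
      filter_upwards [self_mem_nhdsWithin] with u hu
      exact (hφ0 u fun hu' => not_lt.2 hu'.2 hu).symm
    · have hev : ∀ᶠ u in 𝓝[>] s, u ∈ Set.Ioo s ℓ := Ioo_mem_nhdsGT hs0
      have hwt : Tendsto w (𝓝[>] s) (𝓝[Set.Icc a b] (r s)) := by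
        refine tendsto_nhdsWithin_iff.2 ⟨?_, ?_⟩
        · refine tendsto_order.2 ⟨fun v hv => ?_, fun v hv => ?_⟩
          · filter_upwards [hev] with u hu
            have huI : u ∈ Set.Icc 0 ℓ := ⟨hs.1.trans hu.1.le, hu.2.le⟩
            exact hv.trans (hlt _ (hr s hs) _ (hwI u huI)
              (by rw [hσw u huI, hσr s hs]; exact hu.1))
          · have hrb : r s < b := lt_of_le_of_ne (hr s hs).2 fun h => by
              have := hσr s hs
              rw [h, hσb] at this
              exact hs0.ne this.symm
            have hv' : min v b ∈ Set.Icc a b :=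
              ⟨(hr s hs).1.trans (lt_min hv hrb).le, min_le_right _ _⟩
            have hlt' : s < σ (min v b) := lt_of_le_of_ne
              ((hσr s hs).symm.le.trans (hσm (hr s hs) hv' (lt_min hv hrb).le))
              fun h => absurd (hlr s hs _ hv' h.symm).2 (not_le.2 (lt_min hv hrb))
            filter_upwards [hev, Ioo_mem_nhdsGT hlt'] with u hu hu'
            have huI : u ∈ Set.Icc 0 ℓ := ⟨hs.1.trans hu.1.le, hu.2.le⟩
            exact (hlt _ (hwI u huI) _ hv' (by rw [hσw u huI]; exact hu'.2)).trans_le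
              (min_le_left _ _)
        · filter_upwards [hev] with u hu
          exact hwI u ⟨hs.1.trans hu.1.le, hu.2.le⟩
      refine ((hτ (r s) (hr s hs)).tendsto.comp hwt).congr' ?_
      filter_upwards [hev] with u hu
      exact (hφ u ⟨hs.1.trans hu.1.le, hu.2.le⟩).symm
  refine ⟨φ, ⟨?_, hφ0, fun s hs => by rw [hleft s hs, hright s hs, hφ s hs, hτw]⟩, ?_⟩
  · have h1 : eVariationOn φ (Set.Icc 0 ℓ) = eVariationOn (τ ∘ w) (Set.Icc 0 ℓ) :=
      eVariationOn.congr fun s hs => hφ s hs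
    rw [BoundedVariationOn, h1]
    exact ne_top_of_le_ne_top hτv
      (eVariationOn.comp_le_of_monotoneOn τ w hwm fun s hs => hwI s hs)
  · ext ⟨s, t⟩
    constructor
    · rintro ⟨hs, ht⟩
      simp only at hs ht
      rw [segment_eq_uIcc, hleft s hs, hright s hs] at ht
      have hle : l s ≤ r s := (hlr s hs _ (hr s hs) (hσr s hs)).1
      have hsub : Set.Icc (l s) (r s) ⊆ Set.Icc a b := Set.Icc_subset_Icc (hl s hs).1 (hr s hs).2
      obtain ⟨v, hv, rfl⟩ : t ∈ τ '' Set.Icc (l s) (r s) := by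
        have := intermediate_value_uIcc (f := τ) (a := l s) (b := r s)
          (by rw [Set.uIcc_of_le hle]; exact hτ.mono hsub) ht
        rwa [Set.uIcc_of_le hle] at this
      refine ⟨v, hsub hv, Prod.ext ?_ rfl⟩
      exact le_antisymm ((hσm (hsub hv) (hr s hs) hv.2).trans_eq (hσr s hs))
        ((hσl s hs).symm.le.trans (hσm (hl s hs) (hsub hv) hv.1))
    · rintro ⟨v, hv, hvst⟩
      obtain ⟨rfl, rfl⟩ := Prod.mk.inj hvst
      have hs : σ v ∈ Set.Icc 0 ℓ :=
        ⟨hσa ▸ hσm ⟨le_rfl, hab⟩ hv hv.1, hσb ▸ hσm hv ⟨hab, le_rfl⟩ hv.2⟩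
      refine ⟨hs, ?_⟩
      simp only
      rw [segment_eq_uIcc, hleft _ hs, hright _ hs]
      exact hbetween _ (hl _ hs) _ (hr _ hs) _ (hlr _ hs v hv rfl)
        ((hσl _ hs).trans (hσr _ hs).symm)

end MonotonePath

/-! ### Monotone triods and the correction of overlapping branches. -/

section Triod

variable {E : Type*} [TopologicalSpace E]

/-- Coordinates in the plane that behave like the signed lengths along the three sides of a
nondegenerate triangle: they are continuous, satisfy one linear relation with positive
coefficients, and any two of them separate points. -/
structure IsTriangleCoord (w : Fin 3 → ℝ) (c : ℝ) (S : Fin 3 → E → ℝ) : Prop where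
  pos : ∀ i, 0 < w i
  continuous : ∀ i, Continuous (S i)
  relation : ∀ i x, w i * S i x + w (i + 1) * S (i + 1) x + w (i + 2) * S (i + 2) x = c
  eq_of_eq : ∀ i x y, S i x = S i y → S (i + 1) x = S (i + 1) y → x = y

/-- Three compact sets `C i` joining the points `V i` to a common point `p`, each of which is a chain
for the coordinates along the two sides adjacent to `V i`, and such that `C i` and `C (i + 1)` lie
on opposite sides of `p` with respect to the coordinate along the `i`-th side. -/
structure IsMonotoneTriod (V : Fin 3 → E) (S : Fin 3 → E → ℝ) (C : Fin 3 → Set E) (p : E) :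
    Prop where
  isCompact : ∀ i, IsCompact (C i)
  vertex_mem : ∀ i, V i ∈ C i
  center_mem : ∀ i, p ∈ C i
  le_center : ∀ i, ∀ x ∈ C i, S i x ≤ S i p
  center_le : ∀ i, ∀ x ∈ C (i + 1), S i p ≤ S i x
  anti : ∀ i, ∀ x ∈ C i, ∀ y ∈ C i, S i x < S i y → S (i + 2) y ≤ S (i + 2) x
  surj : ∀ i v, S i (V i) - S (i + 2) (V i) ≤ v → v ≤ S i p - S (i + 2) p →
    ∃ x ∈ C i, S i x - S (i + 2) x = v
  vertex_le : ∀ i, ∀ x ∈ C i, S i (V i) ≤ S i x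
  le_vertex : ∀ i, ∀ x ∈ C i, S (i + 2) x ≤ S (i + 2) (V i)

/-- Cyclic relabelling lets the longer arguments be carried out for the indices `0, 1, 2` only. -/
theorem IsTriangleCoord.shift {w : Fin 3 → ℝ} {c : ℝ} {S : Fin 3 → E → ℝ}
    (h : IsTriangleCoord w c S) (k : Fin 3) :
    IsTriangleCoord (fun i => w (i + k)) c (fun i => S (i + k)) where
  pos i := h.pos _
  continuous i := h.continuous _
  relation i x := by
    rw [add_right_comm i 1 k, add_right_comm i 2 k]
    exact h.relation _ x
  eq_of_eq i x y h1 h2 := by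
    rw [add_right_comm i 1 k] at h2
    exact h.eq_of_eq _ x y h1 h2

theorem IsTriangleCoord.eq_of_eq' {w : Fin 3 → ℝ} {c : ℝ} {S : Fin 3 → E → ℝ}
    (h : IsTriangleCoord w c S) (i : Fin 3) {x y : E} (h1 : S i x = S i y)
    (h2 : S (i + 2) x = S (i + 2) y) : x = y := by
  refine h.eq_of_eq i x y h1 ?_
  have hx := h.relation i x
  have hy := h.relation i y
  rw [h1, h2] at hx
  exact mul_left_cancel₀ (h.pos (i + 1)).ne' (by linarith)

/-- On a level set of one coordinate, the other two coordinates are inversely ordered. -/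
theorem IsTriangleCoord.le_iff_le {w : Fin 3 → ℝ} {c : ℝ} {S : Fin 3 → E → ℝ}
    (h : IsTriangleCoord w c S) (i : Fin 3) {x y : E} (hxy : S i x = S i y) :
    S (i + 1) x ≤ S (i + 1) y ↔ S (i + 2) y ≤ S (i + 2) x := by
  have hx := h.relation i x
  have hy := h.relation i y
  rw [hxy] at hx
  have key : w (i + 1) * (S (i + 1) y - S (i + 1) x) = w (i + 2) * (S (i + 2) x - S (i + 2) y) := by
    linarith
  rw [← sub_nonneg, ← sub_nonneg (a := S (i + 2) x), ← mul_nonneg_iff_of_pos_left (h.pos (i + 1)),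
    key, mul_nonneg_iff_of_pos_left (h.pos (i + 2))]

namespace IsMonotoneTriod

variable {V : Fin 3 → E} {S : Fin 3 → E → ℝ} {C : Fin 3 → Set E} {p : E} {w : Fin 3 → ℝ} {c : ℝ}

theorem shift (h : IsMonotoneTriod V S C p) (k : Fin 3) :
    IsMonotoneTriod (fun i => V (i + k)) (fun i => S (i + k)) (fun i => C (i + k)) p where
  isCompact i := h.isCompact _
  vertex_mem i := h.vertex_mem _
  center_mem i := h.center_mem _
  le_center i := h.le_center _
  center_le i := by rw [add_right_comm]; exact h.center_le _
  anti i := by rw [add_right_comm]; exact h.anti _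
  surj i := by rw [add_right_comm]; exact h.surj _
  vertex_le i := h.vertex_le _
  le_vertex i := by rw [add_right_comm]; exact h.le_vertex _

theorem center_le' (h : IsMonotoneTriod V S C p) (i : Fin 3) {x : E} (hx : x ∈ C i) :
    S (i + 2) p ≤ S (i + 2) x := by
  apply h.center_le (i + 2)
  rw [add_assoc]
  simpa using hx

/-- The difference of the two adjacent coordinates orders `C i`. -/
theorem mono (h : IsMonotoneTriod V S C p) {i : Fin 3} {x y : E} (hx : x ∈ C i) (hy : y ∈ C i)
    (hxy : S i x - S (i + 2) x ≤ S i y - S (i + 2) y) :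
    S i x ≤ S i y ∧ S (i + 2) y ≤ S (i + 2) x := by
  rcases lt_trichotomy (S i x) (S i y) with h1 | h1 | h1
  · exact ⟨h1.le, h.anti i x hx y hy h1⟩
  · exact ⟨h1.le, by linarith⟩
  · have := h.anti i y hy x hx h1
    exact ⟨by linarith, by linarith⟩

/-- Both coordinates are monotone in the difference, so the difference determines them. With `surj`
this makes it a bijective parameter on the branch. -/
theorem eq_of_diff_eq (h : IsMonotoneTriod V S C p) (hS : IsTriangleCoord w c S) {i : Fin 3}
    {x y : E} (hx : x ∈ C i) (hy : y ∈ C i)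
    (hxy : S i x - S (i + 2) x = S i y - S (i + 2) y) : x = y := by
  have h1 := h.mono hx hy hxy.le
  have h2 := h.mono hy hx hxy.ge
  exact hS.eq_of_eq' i (le_antisymm h1.1 h2.1) (le_antisymm h2.2 h1.2)

theorem diff_le_center (h : IsMonotoneTriod V S C p) {i : Fin 3} {x : E} (hx : x ∈ C i) :
    S i x - S (i + 2) x ≤ S i p - S (i + 2) p := by
  linarith [h.le_center i x hx, h.center_le' i hx]

theorem vertex_le_diff (h : IsMonotoneTriod V S C p) {i : Fin 3} {x : E} (hx : x ∈ C i) :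
    S i (V i) - S (i + 2) (V i) ≤ S i x - S (i + 2) x := by
  linarith [h.vertex_le i x hx, h.le_vertex i x hx]

/-- A whisker, common to two of the three branches, can be moved to the third branch. -/
theorem exists_move_whisker [T2Space E] (h : IsMonotoneTriod V S C p) (hS : IsTriangleCoord w c S) {x₀ : E}
    (h0 : x₀ ∈ C 0) (h1 : x₀ ∈ C 1) (hx₀ : x₀ ≠ p) :
    ∃ C' q, IsMonotoneTriod V S C' q ∧ (∀ i, C' i ∩ C' (i + 1) = {q}) ∧
      (∀ i, C' i ⊆ ⋃ j, C j) ∧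
      ∀ i x, S i x ≠ S i p → (x ∈ C' i ∪ C' (i + 1) ↔ x ∈ C i ∪ C (i + 1)) := by
  have hu : Continuous fun x => S 0 x - S 2 x := (hS.continuous 0).sub (hS.continuous 2)
  have hu' : Continuous fun x => S 1 x - S 0 x := (hS.continuous 1).sub (hS.continuous 0)
  have hrel : ∀ x, w 0 * S 0 x + w 1 * S 1 x + w 2 * S 2 x = c := hS.relation 0
  have hw0 := hS.pos 0
  have hw1 := hS.pos 1
  have hw2 := hS.pos 2
  -- The specializations of the hypotheses to the three branches.
  have le0 : ∀ x ∈ C 0, S 0 x ≤ S 0 p := h.le_center 0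
  have le1 : ∀ x ∈ C 1, S 1 x ≤ S 1 p := h.le_center 1
  have le2 : ∀ x ∈ C 2, S 2 x ≤ S 2 p := h.le_center 2
  have ge0 : ∀ x ∈ C 0, S 2 p ≤ S 2 x := h.center_le 2
  have ge1 : ∀ x ∈ C 1, S 0 p ≤ S 0 x := h.center_le 0
  have ge2 : ∀ x ∈ C 2, S 1 p ≤ S 1 x := h.center_le 1
  have m0 : ∀ x ∈ C 0, ∀ y ∈ C 0, S 0 x - S 2 x ≤ S 0 y - S 2 y → S 0 x ≤ S 0 y ∧ S 2 y ≤ S 2 x :=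
    fun x hx y hy => h.mono (i := 0) hx hy
  have m1 : ∀ x ∈ C 1, ∀ y ∈ C 1, S 1 x - S 0 x ≤ S 1 y - S 0 y → S 1 x ≤ S 1 y ∧ S 0 y ≤ S 0 x :=
    fun x hx y hy => h.mono (i := 1) hx hy
  have e01 : ∀ x y, S 0 x = S 0 y → S 1 x = S 1 y → x = y := hS.eq_of_eq 0
  have e02 : ∀ x y, S 0 x = S 0 y → S 2 x = S 2 y → x = y := fun x y => hS.eq_of_eq' 0
  have hinv : ∀ x y, S 0 x = S 0 y → (S 1 x ≤ S 1 y ↔ S 2 y ≤ S 2 x) := fun x y => hS.le_iff_le 0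
  -- `q` is the far end of the whisker: the common point of `C 0` and `C 1` that comes first on the
  -- way from `V 0` to `p`.
  obtain ⟨q, ⟨hq0, hq1⟩, hqmin⟩ := ((h.isCompact 0).inter (h.isCompact 1)).exists_isMinOn
    ⟨x₀, h0, h1⟩ hu.continuousOn
  have hqmin' : ∀ x ∈ C 0, x ∈ C 1 → S 0 q - S 2 q ≤ S 0 x - S 2 x := fun x hx hx' =>
    hqmin ⟨hx, hx'⟩
  have hqp : S 0 q = S 0 p := le_antisymm (le0 q hq0) (ge1 q hq1)
  have hx₀p : S 0 x₀ = S 0 p := le_antisymm (le0 x₀ h0) (ge1 x₀ h1)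
  have hx₀2 : S 2 p < S 2 x₀ := lt_of_le_of_ne (ge0 x₀ h0) fun e => hx₀ (e02 _ _ hx₀p e.symm)
  have hq2 : S 2 p < S 2 q := by linarith [hqmin' x₀ h0 h1]
  have hq1' : S 1 q < S 1 p := by
    refine lt_of_not_ge fun e => ?_
    have := (hinv p q hqp.symm).1 e
    linarith
  -- Points of the first two branches beyond `q` lie on the whisker.
  have hW0 : ∀ x ∈ C 0, S 0 q - S 2 q ≤ S 0 x - S 2 x → S 0 x = S 0 p ∧ S 2 x ≤ S 2 q := by
    intro x hx hxq
    have := m0 q hq0 x hx hxq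
    exact ⟨le_antisymm (le0 x hx) (hqp ▸ this.1), this.2⟩
  have hW1 : ∀ x ∈ C 1, S 1 q - S 0 q ≤ S 1 x - S 0 x → S 0 x = S 0 p ∧ S 1 q ≤ S 1 x := by
    intro x hx hxq
    have := m1 q hq1 x hx hxq
    exact ⟨le_antisymm (hqp ▸ this.2) (ge1 x hx), this.1⟩
  have hW01 : ∀ x ∈ C 0, S 0 q - S 2 q ≤ S 0 x - S 2 x →
      x ∈ C 1 ∧ S 1 q - S 0 q ≤ S 1 x - S 0 x := by
    intro x hx hxq
    obtain ⟨hx0, hx2⟩ := hW0 x hx hxq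
    have hx1 : S 1 q ≤ S 1 x := (hinv q x (hqp.trans hx0.symm)).2 hx2
    have hx1' : S 1 x ≤ S 1 p := (hinv x p hx0).2 (ge0 x hx)
    -- `C 1` has a point with the same parameter as `x`. Being beyond `q`, it lies on the same level
    -- of `S 0`, hence equals `x`.
    obtain ⟨y, hy, hyx⟩ : ∃ y ∈ C 1, S 1 y - S 0 y = S 1 x - S 0 x := h.surj 1 _
      (by
        have : S 1 (V 1) - S 0 (V 1) ≤ S 1 q - S 0 q := h.vertex_le_diff (i := 1) hq1
        change S 1 (V 1) - S 0 (V 1) ≤ _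
        linarith)
      (by change _ ≤ S 1 p - S 0 p; linarith)
    have hy0 := (hW1 y hy (by linarith)).1
    have : y = x := e01 _ _ (hy0.trans hx0.symm) (by linarith)
    exact ⟨this ▸ hy, by linarith⟩
  have hW10 : ∀ x ∈ C 1, S 1 q - S 0 q ≤ S 1 x - S 0 x →
      x ∈ C 0 ∧ S 0 q - S 2 q ≤ S 0 x - S 2 x := by
    intro x hx hxq
    obtain ⟨hx0, hx1⟩ := hW1 x hx hxq
    have hx2 : S 2 x ≤ S 2 q := (hinv q x (hqp.trans hx0.symm)).1 hx1
    have hx2' : S 2 p ≤ S 2 x := (hinv x p hx0).1 (le1 x hx)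
    obtain ⟨y, hy, hyx⟩ : ∃ y ∈ C 0, S 0 y - S 2 y = S 0 x - S 2 x := h.surj 0 _
      (by
        have : S 0 (V 0) - S 2 (V 0) ≤ S 0 q - S 2 q := h.vertex_le_diff (i := 0) hq0
        change S 0 (V 0) - S 2 (V 0) ≤ _
        linarith)
      (by change _ ≤ S 0 p - S 2 p; linarith)
    have hy0 := (hW0 y hy (by linarith)).1
    have : y = x := e02 _ _ (hy0.trans hx0.symm) (by linarith)
    exact ⟨this ▸ hy, by linarith⟩
  -- The third branch meets the other two only in `p`.
  have h20 : ∀ x ∈ C 2, x ∈ C 0 → x = p := by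
    intro x hx hx'
    have hx2 : S 2 x = S 2 p := le_antisymm (le2 x hx) (ge0 x hx')
    refine e02 _ _ (le_antisymm (le0 x hx') (le_of_not_gt fun hlt => ?_)) hx2
    have : S 2 q ≤ S 2 x := h.anti 0 x hx' q hq0 (hqp ▸ hlt)
    linarith
  have h12 : ∀ x ∈ C 1, x ∈ C 2 → x = p := by
    intro x hx hx'
    have hx1 : S 1 x = S 1 p := le_antisymm (le1 x hx) (ge2 x hx')
    refine e01 _ _ (le_antisymm (le_of_not_gt fun hlt => ?_) (ge1 x hx)) hx1
    have : S 0 x ≤ S 0 q := h.anti 1 q hq1 x hx (hx1 ▸ hq1')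
    linarith
  -- `W` is the whisker from `q` to `p`. `D0` and `D1` are the branches cut at `q`, and `C 2 ∪ W` is
  -- the third branch prolonged from `p` to `q`.
  let W : Set E := {x | x ∈ C 0 ∧ S 0 q - S 2 q ≤ S 0 x - S 2 x}
  let D0 : Set E := {x | x ∈ C 0 ∧ S 0 x - S 2 x ≤ S 0 q - S 2 q}
  let D1 : Set E := {x | x ∈ C 1 ∧ S 1 x - S 0 x ≤ S 1 q - S 0 q}
  have hWq : ∀ x ∈ W, S 0 x = S 0 p ∧ S 2 x ≤ S 2 q ∧ S 2 p ≤ S 2 x ∧ S 1 q ≤ S 1 x ∧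
      S 1 x ≤ S 1 p := fun x hx => by
    have h1 := hW0 x hx.1 hx.2
    have h2 := hW01 x hx.1 hx.2
    exact ⟨h1.1, h1.2, ge0 x hx.1, (hW1 x h2.1 h2.2).2, le1 x h2.1⟩
  have hqW : q ∈ W := ⟨hq0, le_rfl⟩
  have hpW : p ∈ W := ⟨h.center_mem 0, by linarith⟩
  have hcompact : ∀ i, IsCompact (![D0, D1, C 2 ∪ W] i) := by
    intro i
    fin_cases i
    · exact (h.isCompact 0).inter_right (isClosed_le hu continuous_const)
    · exact (h.isCompact 1).inter_right (isClosed_le hu' continuous_const)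
    · exact (h.isCompact 2).union
        ((h.isCompact 0).inter_right (isClosed_le continuous_const hu))
  have hD0W : ∀ x, x ∈ C 0 ↔ x ∈ D0 ∨ x ∈ W := fun x =>
    ⟨fun hx => (le_total _ _).imp (fun h => ⟨hx, h⟩) fun h => ⟨hx, h⟩,
      fun hx => hx.elim And.left And.left⟩
  have hD1W : ∀ x, x ∈ C 1 ↔ x ∈ D1 ∨ x ∈ W := fun x =>
    ⟨fun hx => (le_total (S 1 x - S 0 x) (S 1 q - S 0 q)).imp (fun h => ⟨hx, h⟩)
      fun h => hW10 x hx h,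
      fun hx => hx.elim And.left fun h => (hW01 x h.1 h.2).1⟩
  have hD0q : ∀ x ∈ D0, x ∈ W → x = q := fun x hx hx' =>
    h.eq_of_diff_eq hS (i := 0) hx.1 hq0 (le_antisymm hx.2 hx'.2)
  have hD1q : ∀ x ∈ D1, x ∈ W → x = q := fun x hx hx' =>
    h.eq_of_diff_eq hS (i := 1) hx.1 hq1 (le_antisymm hx.2 (hW01 x hx'.1 hx'.2).2)
  refine ⟨![D0, D1, C 2 ∪ W], q, ⟨hcompact, ?_, ?_, ?_, ?_, ?_, ?_, ?_, ?_⟩, ?_, ?_, ?_⟩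
  · intro i
    fin_cases i
    · exact ⟨h.vertex_mem 0, h.vertex_le_diff (i := 0) hq0⟩
    · exact ⟨h.vertex_mem 1, h.vertex_le_diff (i := 1) hq1⟩
    · exact Or.inl (h.vertex_mem 2)
  · intro i
    fin_cases i
    · exact ⟨hq0, le_rfl⟩
    · exact ⟨hq1, le_rfl⟩
    · exact Or.inr hqW
  · intro i
    fin_cases i
    · exact fun x hx => (m0 x hx.1 q hq0 hx.2).1
    · exact fun x hx => (m1 x hx.1 q hq1 hx.2).1
    · rintro x (hx | hx)
      · exact (le2 x hx).trans hq2.le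
      · exact (hWq x hx).2.1
  · intro i
    fin_cases i
    · exact fun x hx => (m1 x hx.1 q hq1 hx.2).2
    · rintro x (hx | hx)
      · exact hq1'.le.trans (ge2 x hx)
      · exact (hWq x hx).2.2.2.1
    · exact fun x hx => (m0 x hx.1 q hq0 hx.2).2
  · intro i
    fin_cases i
    · exact fun x hx y hy => h.anti 0 x hx.1 y hy.1
    · exact fun x hx y hy => h.anti 1 x hx.1 y hy.1
    · change ∀ x ∈ C 2 ∪ W, ∀ y ∈ C 2 ∪ W, S 2 x < S 2 y → S 1 y ≤ S 1 x
      -- Mixed pairs are compared through `p`: `C 2` has `S 2 ≤ S 2 p` and `S 1 ≥ S 1 p`, and `W`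
      -- has the opposite inequalities.
      rintro x (hx | hx) y (hy | hy) hxy
      · exact h.anti 2 x hx y hy hxy
      · exact (hWq y hy).2.2.2.2.trans (ge2 x hx)
      · have := le2 y hy
        have := (hWq x hx).2.2.1
        linarith
      · exact (hinv y x ((hWq y hy).1.trans (hWq x hx).1.symm)).2 hxy.le
  · intro i
    fin_cases i
    · intro v hv hv'
      obtain ⟨x, hx, hxv⟩ := h.surj 0 v hv (hv'.trans (h.diff_le_center (i := 0) hq0))
      exact ⟨x, ⟨hx, hxv.trans_le hv'⟩, hxv⟩
    · intro v hv hv'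
      obtain ⟨x, hx, hxv⟩ := h.surj 1 v hv (hv'.trans (h.diff_le_center (i := 1) hq1))
      exact ⟨x, ⟨hx, hxv.trans_le hv'⟩, hxv⟩
    · intro v hv hv'
      change v ≤ S 2 q - S 1 q at hv'
      change ∃ x ∈ C 2 ∪ W, S 2 x - S 1 x = v
      rcases le_total v (S 2 p - S 1 p) with hvp | hvp
      · obtain ⟨x, hx, hxv⟩ := h.surj 2 v hv hvp
        exact ⟨x, Or.inl hx, hxv⟩
      -- On the whisker `S 2 - S 1` is an increasing affine function of `S 2 - S 0`.
      have hpos : 0 < w 1 + w 2 := add_pos hw1 hw2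
      -- `t` is the value of `S 2` forced by `S 0 = S 0 p`, `S 2 - S 1 = v` and the linear relation.
      set t := (c - w 0 * S 0 p + w 1 * v) / (w 1 + w 2) with ht
      have ht' : (w 1 + w 2) * t = c - w 0 * S 0 p + w 1 * v := mul_div_cancel₀ _ hpos.ne'
      have hrp := hrel p
      have hrq := hrel q
      rw [hqp] at hrq
      have htp : S 2 p ≤ t := by
        rw [ht, le_div_iff₀ hpos]
        nlinarith
      have htq : t ≤ S 2 q := by
        rw [ht, div_le_iff₀ hpos]
        nlinarith
      obtain ⟨x, hx, hxv⟩ : ∃ x ∈ C 0, S 0 x - S 2 x = S 0 p - t := h.surj 0 _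
        (by
          have : S 0 (V 0) - S 2 (V 0) ≤ S 0 q - S 2 q := h.vertex_le_diff (i := 0) hq0
          change S 0 (V 0) - S 2 (V 0) ≤ _
          linarith)
        (by change _ ≤ S 0 p - S 2 p; linarith)
      have hxW : x ∈ W := ⟨hx, by linarith⟩
      have hx0 := (hWq x hxW).1
      have hx2 : S 2 x = t := by linarith
      have hrx := hrel x
      rw [hx0, hx2] at hrx
      exact ⟨x, Or.inr hxW, by rw [hx2]; exact mul_left_cancel₀ hw1.ne' (by linarith)⟩
  · intro i
    fin_cases i
    · exact fun x hx => h.vertex_le 0 x hx.1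
    · exact fun x hx => h.vertex_le 1 x hx.1
    · rintro x (hx | hx)
      · exact h.vertex_le 2 x hx
      · exact (h.vertex_le 2 p (h.center_mem 2)).trans (hWq x hx).2.2.1
  · intro i
    fin_cases i
    · exact fun x hx => h.le_vertex 0 x hx.1
    · exact fun x hx => h.le_vertex 1 x hx.1
    · rintro x (hx | hx)
      · exact h.le_vertex 2 x hx
      · exact (hWq x hx).2.2.2.2.trans (h.le_vertex 2 p (h.center_mem 2))
  · intro i
    fin_cases i
    · refine Set.Subset.antisymm (fun x hx => ?_)
        (Set.singleton_subset_iff.2 ⟨⟨hq0, le_rfl⟩, ⟨hq1, le_rfl⟩⟩)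
      exact hD0q x hx.1 ⟨hx.1.1, hqmin' x hx.1.1 hx.2.1⟩
    · refine Set.Subset.antisymm (fun x hx => ?_)
        (Set.singleton_subset_iff.2 ⟨⟨hq1, le_rfl⟩, Or.inr hqW⟩)
      rcases hx.2 with hx2 | hx2
      · exact hD1q x hx.1 (h12 x hx.1.1 hx2 ▸ hpW)
      · exact hD1q x hx.1 hx2
    · refine Set.Subset.antisymm (fun x hx => ?_)
        (Set.singleton_subset_iff.2 ⟨Or.inr hqW, ⟨hq0, le_rfl⟩⟩)
      rcases hx.1 with hx2 | hx2
      · exact hD0q x hx.2 (h20 x hx2 hx.2.1 ▸ hpW)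
      · exact hD0q x hx.2 hx2
  · intro i
    fin_cases i
    · exact fun x hx => Set.mem_iUnion.2 ⟨0, hx.1⟩
    · exact fun x hx => Set.mem_iUnion.2 ⟨1, hx.1⟩
    · rintro x (hx | hx)
      · exact Set.mem_iUnion.2 ⟨2, hx⟩
      · exact Set.mem_iUnion.2 ⟨0, hx.1⟩
  · intro i x hxp
    fin_cases i
    · change x ∈ D0 ∪ D1 ↔ x ∈ C 0 ∪ C 1
      -- Only the union opposite to the third branch loses points, and all of them lie over the
      -- level `S 0 = S 0 p`.
      have : x ∉ W := fun hx => hxp (hWq x hx).1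
      simp only [Set.mem_union, hD0W, hD1W]
      tauto
    · change x ∈ D1 ∪ (C 2 ∪ W) ↔ x ∈ C 1 ∪ C 2
      simp only [Set.mem_union, hD1W]
      tauto
    · change x ∈ (C 2 ∪ W) ∪ D0 ↔ x ∈ C 2 ∪ C 0
      simp only [Set.mem_union, hD0W]
      tauto

/-- Every monotone triod can be modified, over a single level of each coordinate, so that its
branches meet pairwise in a single common point. -/
theorem exists_inter_eq_singleton [T2Space E] (h : IsMonotoneTriod V S C p)
    (hS : IsTriangleCoord w c S) :
    ∃ C' q, IsMonotoneTriod V S C' q ∧ (∀ i, C' i ∩ C' (i + 1) = {q}) ∧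
      (∀ i, C' i ⊆ ⋃ j, C j) ∧
      ∀ i x, S i x ≠ S i p → (x ∈ C' i ∪ C' (i + 1) ↔ x ∈ C i ∪ C (i + 1)) := by
  by_cases hcon : ∃ k x, x ∈ C k ∧ x ∈ C (k + 1) ∧ x ≠ p
  · obtain ⟨k, x, hxk, hxk1, hxp⟩ := hcon
    obtain ⟨C', q, h1, h2, h3, h4⟩ := (h.shift k).exists_move_whisker (hS.shift k) (x₀ := x)
      (by simpa using hxk) (by simpa [add_comm] using hxk1) hxp
    refine ⟨fun i => C' (i - k), q, ?_, fun i => ?_, fun i => ?_, fun i x hx => ?_⟩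
    · simpa [sub_eq_add_neg] using h1.shift (-k)
    · have := h2 (i - k)
      rwa [sub_add_eq_add_sub] at this
    · refine (h3 (i - k)).trans (Set.iUnion_subset fun j => Set.subset_iUnion C _)
    · have := h4 (i - k) x (by simpa using hx)
      rwa [sub_add_eq_add_sub, sub_add_cancel, sub_add_cancel] at this
  · push Not at hcon
    refine ⟨C, p, h, fun i => ?_, fun i => Set.subset_iUnion C i, fun i x _ => Iff.rfl⟩
    exact Set.Subset.antisymm (fun x hx => hcon i x hx.1 hx.2)
      (Set.singleton_subset_iff.2 ⟨h.center_mem i, h.center_mem (i + 1)⟩)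

end IsMonotoneTriod

end Triod

/-! ### From monotone triods back to BV graphs. -/

theorem lipschitzOnWith_Icc_of_halves {a b L : ℝ} {g : ℝ → ℝ} (hL : 0 ≤ L)
    (h1 : ∀ u v, a ≤ u → u ≤ v → v ≤ 0 → |g u - g v| ≤ L * (v - u))
    (h2 : ∀ u v, 0 ≤ u → u ≤ v → v ≤ b → |g u - g v| ≤ L * (v - u)) :
    LipschitzOnWith L.toNNReal g (Set.Icc a b) := by
  have key : ∀ u v, a ≤ u → u ≤ v → v ≤ b → |g u - g v| ≤ L * (v - u) := by
    intro u v hu huv hv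
    rcases le_total v 0 with hv0 | hv0
    · exact h1 u v hu huv hv0
    rcases le_total 0 u with hu0 | hu0
    · exact h2 u v hu0 huv hv
    · have e1 := h1 u 0 hu hu0 le_rfl
      have e2 := h2 0 v le_rfl hv0 hv
      have e3 := abs_sub_le (g u) (g 0) (g v)
      linarith
  refine LipschitzOnWith.of_dist_le_mul fun u hu v hv => ?_
  rw [Real.dist_eq, Real.dist_eq, Real.coe_toNNReal L hL]
  rcases le_total u v with huv | huv
  · rw [abs_sub_comm u v, abs_of_nonneg (sub_nonneg.2 huv)]
    exact key u v hu.1 huv hv.2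
  · rw [abs_sub_comm (g u), abs_of_nonneg (sub_nonneg.2 huv)]
    exact key v u hv.1 huv hu.2

namespace IsMonotoneTriod

variable {E : Type*} [TopologicalSpace E] {V : Fin 3 → E} {S : Fin 3 → E → ℝ} {C : Fin 3 → Set E}
  {q : E} {w : Fin 3 → ℝ} {c : ℝ}

/-- If two branches of a monotone triod meet only in one point, then their union is the generalized
graph of a good BV function. -/
theorem exists_isGoodBV_zero (h : IsMonotoneTriod V S C q) (hS : IsTriangleCoord w c S)
    (hq : C 0 ∩ C 1 = {q}) {ℓ A B d : ℝ} {T : E → ℝ} (hT : ∀ x, T x = A * S 0 x + B * S 2 x + d)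
    (hV0 : S 0 (V 0) = 0) (hV1 : S 0 (V 1) = ℓ) (hT0 : T (V 0) = 0) (hT1 : T (V 1) = 0) :
    ∃ φ, IsGoodBV ℓ φ ∧ generalizedGraph ℓ φ = (fun x => (S 0 x, T x)) '' (C 0 ∪ C 1) := by
  have m0 : ∀ x ∈ C 0, ∀ y ∈ C 0, S 0 x - S 2 x ≤ S 0 y - S 2 y → S 0 x ≤ S 0 y ∧ S 2 y ≤ S 2 x :=
    fun x hx y hy => h.mono (i := 0) hx hy
  have m1 : ∀ x ∈ C 1, ∀ y ∈ C 1, S 1 x - S 0 x ≤ S 1 y - S 0 y → S 1 x ≤ S 1 y ∧ S 0 y ≤ S 0 x :=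
    fun x hx y hy => h.mono (i := 1) hx hy
  have hrel : ∀ x, w 0 * S 0 x + w 1 * S 1 x + w 2 * S 2 x = c := hS.relation 0
  have hinv : ∀ x y, S 0 x = S 0 y → (S 1 x ≤ S 1 y ↔ S 2 y ≤ S 2 x) := fun x y => hS.le_iff_le 0
  have hw0 := hS.pos 0
  have hw1 := hS.pos 1
  have hw2 := hS.pos 2
  have hq0 := h.center_mem 0
  have hq1 := h.center_mem 1
  have u0q : ∀ x ∈ C 0, S 0 x - S 2 x ≤ S 0 q - S 2 q := fun x => h.diff_le_center (i := 0)
  have u1q : ∀ x ∈ C 1, S 1 x - S 0 x ≤ S 1 q - S 0 q := fun x => h.diff_le_center (i := 1)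
  have u0V : ∀ x ∈ C 0, S 0 (V 0) - S 2 (V 0) ≤ S 0 x - S 2 x := fun x =>
    h.vertex_le_diff (i := 0)
  have u1V : ∀ x ∈ C 1, S 1 (V 1) - S 0 (V 1) ≤ S 1 x - S 0 x := fun x =>
    h.vertex_le_diff (i := 1)
  have s0 : ∀ v, S 0 (V 0) - S 2 (V 0) ≤ v → v ≤ S 0 q - S 2 q →
    ∃ x ∈ C 0, S 0 x - S 2 x = v := h.surj 0
  have s1 : ∀ v, S 1 (V 1) - S 0 (V 1) ≤ v → v ≤ S 1 q - S 0 q →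
    ∃ x ∈ C 1, S 1 x - S 0 x = v := h.surj 1
  set a := S 0 (V 0) - S 2 (V 0) - (S 0 q - S 2 q) with ha
  set b := S 1 q - S 0 q - (S 1 (V 1) - S 0 (V 1)) with hb
  have ha0 : a ≤ 0 := sub_nonpos.2 (u0V q hq0)
  have hb0 : 0 ≤ b := sub_nonneg.2 (u1V q hq1)
  -- The path runs along `C 0` for `v ≤ 0` and backwards along `C 1` for `v ≥ 0`, passing `q` at `v
  -- = 0`. Outside `[a, b]` the value `q` is a dummy.
  have hpath : ∀ v, ∃ x, (a ≤ v → v ≤ 0 → x ∈ C 0 ∧ S 0 x - S 2 x = S 0 q - S 2 q + v) ∧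
      (0 ≤ v → v ≤ b → x ∈ C 1 ∧ S 1 x - S 0 x = S 1 q - S 0 q - v) := by
    intro v
    rcases lt_trichotomy v 0 with hv | rfl | hv
    · by_cases hav : a ≤ v
      · obtain ⟨x, hx⟩ := s0 (S 0 q - S 2 q + v) (by linarith) (by linarith)
        exact ⟨x, fun _ _ => hx, fun h => absurd h (not_le.2 hv)⟩
      · exact ⟨q, fun h => absurd h hav, fun h => absurd h (not_le.2 hv)⟩
    · exact ⟨q, fun _ _ => ⟨hq0, by ring⟩, fun _ _ => ⟨hq1, by ring⟩⟩
    · by_cases hvb : v ≤ b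
      · obtain ⟨x, hx⟩ := s1 (S 1 q - S 0 q - v) (by linarith) (by linarith)
        exact ⟨x, fun _ h => absurd h (not_le.2 hv), fun _ _ => hx⟩
      · exact ⟨q, fun _ h => absurd h (not_le.2 hv), fun _ h => absurd h hvb⟩
  choose γ hγ0 hγ1 using hpath
  have hL : 0 ≤ (w 0 + w 1) / w 2 := (div_pos (add_pos hw0 hw1) hw2).le
  -- Along each half of the path all coordinates are monotone.
  have half0 : ∀ u v, a ≤ u → u ≤ v → v ≤ 0 →
      S 0 (γ u) ≤ S 0 (γ v) ∧ S 2 (γ v) ≤ S 2 (γ u) ∧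
        S 0 (γ v) - S 0 (γ u) + (S 2 (γ u) - S 2 (γ v)) = v - u := by
    intro u v hu huv hv
    obtain ⟨hx, hxu⟩ := hγ0 u hu (huv.trans hv)
    obtain ⟨hy, hyv⟩ := hγ0 v (hu.trans huv) hv
    have := m0 _ hx _ hy (by linarith)
    exact ⟨this.1, this.2, by linarith⟩
  have half1 : ∀ u v, 0 ≤ u → u ≤ v → v ≤ b →
      S 0 (γ u) ≤ S 0 (γ v) ∧ S 1 (γ v) ≤ S 1 (γ u) ∧
        S 0 (γ v) - S 0 (γ u) + (S 1 (γ u) - S 1 (γ v)) = v - u := by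
    intro u v hu huv hv
    obtain ⟨hx, hxu⟩ := hγ1 u hu (huv.trans hv)
    obtain ⟨hy, hyv⟩ := hγ1 v (hu.trans huv) hv
    have := m1 _ hy _ hx (by linarith)
    exact ⟨this.2, this.1, by linarith⟩
  have hσm : MonotoneOn (fun v => S 0 (γ v)) (Set.Icc a b) := by
    rw [← Set.Icc_union_Icc_eq_Icc ha0 hb0]
    exact MonotoneOn.union_right (fun u hu v hv huv => (half0 u v hu.1 huv hv.2).1)
      (fun u hu v hv huv => (half1 u v hu.1 huv hv.2).1) (isGreatest_Icc ha0) (isLeast_Icc hb0)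
  have hσL : LipschitzOnWith (1 : ℝ).toNNReal (fun v => S 0 (γ v)) (Set.Icc a b) := by
    refine lipschitzOnWith_Icc_of_halves zero_le_one (fun u v hu huv hv => ?_)
      fun u v hu huv hv => ?_
    · obtain ⟨e1, e2, e3⟩ := half0 u v hu huv hv
      rw [abs_le]
      constructor <;> linarith
    · obtain ⟨e1, e2, e3⟩ := half1 u v hu huv hv
      rw [abs_le]
      constructor <;> linarith
  -- In the constant for `S 2`, the `1` serves the half on `C 0`. The quotient serves the half on `C
  -- 1`, where `S 2` is controlled only through the linear relation.
  have hTlip : ∀ x y t, |S 0 x - S 0 y| ≤ t → |S 2 x - S 2 y| ≤ (1 + (w 0 + w 1) / w 2) * t →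
      |T x - T y| ≤ (|A| + |B| * (1 + (w 0 + w 1) / w 2)) * t := by
    intro x y t h1 h2
    have : T x - T y = A * (S 0 x - S 0 y) + B * (S 2 x - S 2 y) := by rw [hT, hT]; ring
    rw [this]
    refine (abs_add_le _ _).trans ?_
    rw [abs_mul, abs_mul, add_mul, mul_assoc]
    exact add_le_add (mul_le_mul_of_nonneg_left h1 (abs_nonneg A))
      (mul_le_mul_of_nonneg_left h2 (abs_nonneg B))
  have hτL : LipschitzOnWith (|A| + |B| * (1 + (w 0 + w 1) / w 2)).toNNReal
      (fun v => T (γ v)) (Set.Icc a b) := by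
    refine lipschitzOnWith_Icc_of_halves (by positivity) (fun u v hu huv hv => ?_)
      fun u v hu huv hv => ?_
    · obtain ⟨e1, e2, e3⟩ := half0 u v hu huv hv
      have : 0 ≤ (w 0 + w 1) / w 2 * (v - u) := mul_nonneg hL (sub_nonneg.2 huv)
      apply hTlip <;> rw [abs_le] <;> constructor <;> linarith
    · obtain ⟨e1, e2, e3⟩ := half1 u v hu huv hv
      have hx := hrel (γ u)
      have hy := hrel (γ v)
      have e4 : S 2 (γ u) - S 2 (γ v) = (w 0 * (S 0 (γ v) - S 0 (γ u)) -
          w 1 * (S 1 (γ u) - S 1 (γ v))) / w 2 := by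
        rw [eq_div_iff hw2.ne']
        linarith
      have e5 : |S 2 (γ u) - S 2 (γ v)| ≤ (w 0 + w 1) / w 2 * (v - u) := by
        rw [e4, abs_div, abs_of_pos hw2, div_mul_eq_mul_div]
        refine div_le_div_of_nonneg_right ?_ hw2.le
        rw [abs_le]
        constructor <;> nlinarith
      apply hTlip
      · rw [abs_le]
        constructor <;> linarith
      · linarith
  have hγa : γ a = V 0 := h.eq_of_diff_eq hS (i := 0) (hγ0 a le_rfl ha0).1 (h.vertex_mem 0)
    ((hγ0 a le_rfl ha0).2.trans (by rw [ha]; change _ = S 0 (V 0) - S 2 (V 0); ring))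
  have hγb : γ b = V 1 := h.eq_of_diff_eq hS (i := 1) (hγ1 b hb0 le_rfl).1 (h.vertex_mem 1)
    ((hγ1 b hb0 le_rfl).2.trans (by rw [hb]; change _ = S 1 (V 1) - S 0 (V 1); ring))
  have hbetween : ∀ x y z, S 0 x = S 0 y → S 0 z = S 0 y → S 2 z ∈ Set.uIcc (S 2 x) (S 2 y) →
      T z ∈ Set.uIcc (T x) (T y) := by
    intro x y z hxy hzy hz
    rw [hT, hT, hT, hxy, hzy]
    rw [Set.mem_uIcc] at hz ⊢
    rcases le_total 0 B with hB | hB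
    · refine hz.imp (fun hz => ?_) fun hz => ?_ <;>
      · have := mul_le_mul_of_nonneg_left hz.1 hB
        have := mul_le_mul_of_nonneg_left hz.2 hB
        constructor <;> linarith
    · refine hz.symm.imp (fun hz => ?_) fun hz => ?_ <;>
      · have := mul_le_mul_of_nonpos_left hz.1 hB
        have := mul_le_mul_of_nonpos_left hz.2 hB
        constructor <;> linarith
  -- The vertical parts of the two branches at `q` point in the same direction.
  have hwhisker : ∀ x ∈ C 0, ∀ y ∈ C 1, S 0 x = S 0 q → S 0 y = S 0 q → x = q ∨ y = q := by
    intro x hx y hy hxq hyq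
    have hx2 : S 2 q ≤ S 2 x := h.center_le' 0 hx
    have hx1 := (hinv x q hxq).2 hx2
    have hy1 : S 1 y ≤ S 1 q := h.le_center 1 y hy
    have hy2 := (hinv y q hyq).1 hy1
    have hinter : ∀ z, z ∈ C 0 → z ∈ C 1 → z = q := fun z hz hz' => by
      have : z ∈ C 0 ∩ C 1 := ⟨hz, hz'⟩
      rwa [hq] at this
    -- Of two vertical parts pointing the same way the longer contains the tip of the shorter, by
    -- `surj`. That tip is then common to both branches, so it is `q`.
    rcases le_total (S 2 x) (S 2 y) with hxy | hxy
    · have hxy1 := (hinv y x (hyq.trans hxq.symm)).2 hxy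
      obtain ⟨z, hz, hzx⟩ := s1 (S 1 x - S 0 x) (by linarith [u1V y hy]) (by linarith)
      have e1 := m1 y hy z hz (by linarith)
      have e2 := m1 z hz q hq1 (by linarith)
      have hzx' : z = x := hS.eq_of_eq 0 z x (by linarith) (by change S 1 z = S 1 x; linarith)
      exact Or.inl (hinter x hx (hzx' ▸ hz))
    · obtain ⟨z, hz, hzy⟩ := s0 (S 0 y - S 2 y) (by linarith [u0V x hx]) (by linarith)
      have e1 := m0 x hx z hz (by linarith)
      have e2 := m0 z hz q hq0 (by linarith)
      have hzy' : z = y := hS.eq_of_eq' 0 (by linarith) (by change S 2 z = S 2 y; linarith)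
      exact Or.inr (hinter y (hzy' ▸ hz) hy)
  obtain ⟨φ, hφ, hG⟩ := exists_isGoodBV_generalizedGraph_eq_image (ℓ := ℓ) (ha0.trans hb0)
    hσL.continuousOn hσm hτL.continuousOn
    (by
      have := hτL.locallyBoundedVariationOn a b ⟨le_rfl, ha0.trans hb0⟩ ⟨ha0.trans hb0, le_rfl⟩
      rwa [Set.inter_self] at this)
    (by simp only [hγa, hV0]) (by simp only [hγb, hV1]) (by simp only [hγa, hT0])
    (by simp only [hγb, hT1])
    (by
      intro u hu v hv z hz huv
      have hzI : z ∈ Set.Icc a b := ⟨hu.1.trans hz.1, hz.2.trans hv.2⟩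
      have e1 := hσm hu hzI hz.1
      have e2 := hσm hzI hv hz.2
      simp only at e1 e2
      have hzv : S 0 (γ z) = S 0 (γ v) := le_antisymm e2 (huv ▸ e1)
      refine hbetween _ _ _ huv hzv ?_
      rcases le_or_gt v 0 with hv0 | hv0
      · exact Set.mem_uIcc.2 (Or.inr ⟨(half0 z v hzI.1 hz.2 hv0).2.1,
          (half0 u z hu.1 hz.1 (hz.2.trans hv0)).2.1⟩)
      rcases le_or_gt 0 u with hu0 | hu0
      · have f1 := (half1 u z hu0 hz.1 hzI.2).2.1
        have f2 := (half1 z v (hu0.trans hz.1) hz.2 hv.2).2.1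
        exact Set.mem_uIcc.2 (Or.inl ⟨(hinv _ _ (hzv.trans huv.symm)).1 f1,
          (hinv _ _ hzv.symm).1 f2⟩)
      -- A fibre containing times on both sides of `0` would lie over `S 0 q`, so one of the two
      -- points would be `q`, which is reached only at time `0`.
      · exfalso
        obtain ⟨hxu, hxu'⟩ := hγ0 u hu.1 hu0.le
        obtain ⟨hyv, hyv'⟩ := hγ1 v hv0.le hv.2
        have g1 : S 0 (γ u) ≤ S 0 q := h.le_center 0 _ hxu
        have g2 : S 0 q ≤ S 0 (γ v) := h.center_le 0 _ hyv
        rcases hwhisker _ hxu _ hyv (by linarith) (by linarith) with hq' | hq'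
        · rw [hq'] at hxu'
          linarith
        · rw [hq'] at hyv'
          linarith)
  refine ⟨φ, hφ, hG.trans ?_⟩
  have himage : γ '' Set.Icc a b = C 0 ∪ C 1 := by
    ext x
    constructor
    · rintro ⟨v, hv, rfl⟩
      rcases le_total v 0 with hv0 | hv0
      · exact Or.inl (hγ0 v hv.1 hv0).1
      · exact Or.inr (hγ1 v hv0 hv.2).1
    · rintro (hx | hx)
      · have e1 := u0V x hx
        have e2 := u0q x hx
        have e3 : a ≤ S 0 x - S 2 x - (S 0 q - S 2 q) := by linarith
        have e4 : S 0 x - S 2 x - (S 0 q - S 2 q) ≤ 0 := by linarith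
        refine ⟨_, ⟨e3, e4.trans hb0⟩, ?_⟩
        obtain ⟨f1, f2⟩ := hγ0 _ e3 e4
        exact h.eq_of_diff_eq hS (i := 0) f1 hx
          (f2.trans (by change _ = S 0 x - S 2 x; ring))
      · have e1 := u1V x hx
        have e2 := u1q x hx
        have e3 : 0 ≤ S 1 q - S 0 q - (S 1 x - S 0 x) := by linarith
        have e4 : S 1 q - S 0 q - (S 1 x - S 0 x) ≤ b := by linarith
        refine ⟨_, ⟨ha0.trans e3, e4⟩, ?_⟩
        obtain ⟨f1, f2⟩ := hγ1 _ e3 e4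
        exact h.eq_of_diff_eq hS (i := 1) f1 hx
          (f2.trans (by change _ = S 1 x - S 0 x; ring))
  rw [← himage, Set.image_image]

theorem exists_isGoodBV (h : IsMonotoneTriod V S C q) (hS : IsTriangleCoord w c S) {i : Fin 3}
    (hq : C i ∩ C (i + 1) = {q}) {ℓ A B d : ℝ} {T : E → ℝ}
    (hT : ∀ x, T x = A * S i x + B * S (i + 2) x + d)
    (hV0 : S i (V i) = 0) (hV1 : S i (V (i + 1)) = ℓ) (hT0 : T (V i) = 0)
    (hT1 : T (V (i + 1)) = 0) :
    ∃ φ, IsGoodBV ℓ φ ∧ generalizedGraph ℓ φ = (fun x => (S i x, T x)) '' (C i ∪ C (i + 1)) := by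
  have := (h.shift i).exists_isGoodBV_zero (hS.shift i) (T := T) (ℓ := ℓ) (A := A) (B := B) (d := d)
  simp only [zero_add, add_comm 1 i, add_comm 2 i] at this
  exact this hq hT hV0 hV1 hT0 hT1

end IsMonotoneTriod

/-! ### Kuratowski limits of compact sets and of triods. -/

section Kuratowski

variable {E : Type*}

/-- Convergence of sets in the sense of Kuratowski: every point of the limit is a limit of points of
the sets, and every other point has a neighbourhood that is eventually disjoint from the sets. -/
structure KuratowskiTendsto [TopologicalSpace E] (K : ℕ → Set E) (C : Set E) : Prop where
  exists_tendsto : ∀ x ∈ C, ∃ y : ℕ → E, (∀ n, y n ∈ K n) ∧ Tendsto y atTop (𝓝 x)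
  exists_disjoint : ∀ x ∉ C, ∃ U ∈ 𝓝 x, ∀ᶠ n in atTop, Disjoint (K n) U

theorem KuratowskiTendsto.mem_of_mapClusterPt [TopologicalSpace E] {K : ℕ → Set E} {C : Set E}
    (h : KuratowskiTendsto K C) {y : ℕ → E} {x : E} (hy : ∀ n, y n ∈ K n)
    (hx : MapClusterPt x atTop y) : x ∈ C := by
  by_contra hxC
  obtain ⟨U, hU, hdisj⟩ := h.exists_disjoint x hxC
  obtain ⟨n, hn, hn'⟩ := ((hx.frequently hU).and_eventually hdisj).exists
  exact Set.disjoint_left.1 hn' (hy n) hn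

theorem KuratowskiTendsto.union [TopologicalSpace E] {K K' : ℕ → Set E} {C C' : Set E}
    (h : KuratowskiTendsto K C) (h' : KuratowskiTendsto K' C') :
    KuratowskiTendsto (fun n => K n ∪ K' n) (C ∪ C') where
  exists_tendsto := by
    rintro x (hx | hx)
    · obtain ⟨y, hy, hyx⟩ := h.exists_tendsto x hx
      exact ⟨y, fun n => Or.inl (hy n), hyx⟩
    · obtain ⟨y, hy, hyx⟩ := h'.exists_tendsto x hx
      exact ⟨y, fun n => Or.inr (hy n), hyx⟩
  exists_disjoint x hx := by
    rw [Set.mem_union, not_or] at hx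
    obtain ⟨U, hU, hd⟩ := h.exists_disjoint x hx.1
    obtain ⟨U', hU', hd'⟩ := h'.exists_disjoint x hx.2
    refine ⟨U ∩ U', inter_mem hU hU', ?_⟩
    filter_upwards [hd, hd'] with n h1 h2
    exact Set.disjoint_union_left.2
      ⟨h1.mono_right Set.inter_subset_left, h2.mono_right Set.inter_subset_right⟩

/-- Countable families of nonempty compact subsets of a compact set are sequentially precompact. -/
theorem exists_kuratowskiTendsto_subseq [MetricSpace E] {ι : Type*} [Countable ι] {T : Set E}
    (hT : IsCompact T) {K : ℕ → ι → Set E} (hK : ∀ n i, IsCompact (K n i))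
    (hne : ∀ n i, (K n i).Nonempty) (hKT : ∀ n i, K n i ⊆ T) :
    ∃ (k : ℕ → ℕ) (C : ι → Set E), StrictMono k ∧ ∀ i, IsCompact (C i) ∧ C i ⊆ T ∧
      KuratowskiTendsto (fun n => K (k n) i) (C i) := by
  have : CompactSpace T := isCompact_iff_compactSpace.1 hT
  let A : ℕ → ι → TopologicalSpace.NonemptyCompacts T := fun n i =>
    ⟨⟨Subtype.val ⁻¹' K n i,
      ((hK n i).isClosed.preimage continuous_subtype_val).isCompact⟩, by
      obtain ⟨x, hx⟩ := hne n i
      exact ⟨⟨x, hKT n i hx⟩, hx⟩⟩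
  -- Nonempty compact subsets of `T` form a compact space for the Hausdorff metric, and so do
  -- countable families of them. Distance to a fixed point depends continuously on the set, which
  -- yields both halves of Kuratowski convergence.
  obtain ⟨L, k, hk, hL⟩ := CompactSpace.tendsto_subseq A
  have hinf : ∀ i (z : T), Tendsto (fun n => Metric.infDist z (A (k n) i : Set T)) atTop
      (𝓝 (Metric.infDist z (L i : Set T))) := fun i z =>
    ((Metric.lipschitz_infDist_set z).continuous.tendsto (L i)).comp (tendsto_pi_nhds.1 hL i)
  refine ⟨k, fun i => Subtype.val '' (L i : Set T), hk, fun i =>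
    ⟨(L i).isCompact.image continuous_subtype_val, ?_, ?_, ?_⟩⟩
  · rintro _ ⟨z, -, rfl⟩
    exact z.2
  · rintro _ ⟨z, hz, rfl⟩
    choose y hy hyz using fun n =>
      (A (k n) i).isCompact.exists_infDist_eq_dist (A (k n) i).nonempty z
    refine ⟨fun n => y n, hy, (continuous_subtype_val.tendsto z).comp ?_⟩
    rw [tendsto_iff_dist_tendsto_zero]
    have := hinf i z
    rw [Metric.infDist_zero_of_mem hz] at this
    refine this.congr fun n => ?_
    rw [hyz, dist_comm]
  · intro x hx
    by_cases hxT : x ∈ T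
    · have hz : (⟨x, hxT⟩ : T) ∉ (L i : Set T) := fun h => hx ⟨_, h, rfl⟩
      have hpos := ((L i).isCompact.isClosed.notMem_iff_infDist_pos (L i).nonempty).1 hz
      refine ⟨_, Metric.ball_mem_nhds x (half_pos hpos), ?_⟩
      filter_upwards [(hinf i ⟨x, hxT⟩).eventually (lt_mem_nhds (half_lt_self hpos))] with n hn
      refine Set.disjoint_left.2 fun y hy hyx => ?_
      have hmem : (⟨y, hKT _ i hy⟩ : T) ∈ (A (k n) i : Set T) := hy
      have h1 := Metric.infDist_le_dist_of_mem (x := (⟨x, hxT⟩ : T)) hmem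
      rw [Metric.mem_ball, dist_comm] at hyx
      exact absurd (hn.trans_le h1) (not_lt.2 hyx.le)
    · refine ⟨Tᶜ, hT.isClosed.isOpen_compl.mem_nhds hxT, Eventually.of_forall fun n => ?_⟩
      exact Set.disjoint_left.2 fun y hy hy' => hy' (hKT _ _ hy)

/-- Monotone triods with given vertices are closed under convergence. -/
theorem IsMonotoneTriod.of_kuratowskiTendsto [MetricSpace E] {V : Fin 3 → E}
    {S : Fin 3 → E → ℝ} {T : Set E} (hT : IsCompact T) (hS : ∀ i, Continuous (S i))
    {K : ℕ → Fin 3 → Set E} {C : Fin 3 → Set E} {pn : ℕ → E} {p : E}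
    (h : ∀ n, IsMonotoneTriod V S (K n) (pn n)) (hKT : ∀ n i, K n i ⊆ T)
    (hC : ∀ i, IsCompact (C i)) (hKC : ∀ i, KuratowskiTendsto (fun n => K n i) (C i))
    (hp : Tendsto pn atTop (𝓝 p)) : IsMonotoneTriod V S C p where
  isCompact := hC
  vertex_mem i := (hKC i).mem_of_mapClusterPt (fun n => (h n).vertex_mem i)
    tendsto_const_nhds.mapClusterPt
  center_mem i := (hKC i).mem_of_mapClusterPt (fun n => (h n).center_mem i) hp.mapClusterPt
  le_center i x hx := by
    obtain ⟨y, hy, hyx⟩ := (hKC i).exists_tendsto x hx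
    exact le_of_tendsto_of_tendsto' (((hS i).tendsto x).comp hyx) (((hS i).tendsto p).comp hp)
      fun n => (h n).le_center i _ (hy n)
  center_le i x hx := by
    obtain ⟨y, hy, hyx⟩ := (hKC (i + 1)).exists_tendsto x hx
    exact le_of_tendsto_of_tendsto' (((hS i).tendsto p).comp hp) (((hS i).tendsto x).comp hyx)
      fun n => (h n).center_le i _ (hy n)
  anti i x hx x' hx' hxx' := by
    obtain ⟨y, hy, hyx⟩ := (hKC i).exists_tendsto x hx
    obtain ⟨y', hy', hyx'⟩ := (hKC i).exists_tendsto x' hx'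
    refine le_of_tendsto_of_tendsto (((hS (i + 2)).tendsto x').comp hyx')
      (((hS (i + 2)).tendsto x).comp hyx) ?_
    filter_upwards [(((hS i).tendsto x).comp hyx).eventually_lt
      (((hS i).tendsto x').comp hyx') hxx'] with n hn
    exact (h n).anti i _ (hy n) _ (hy' n) hn
  surj i v hv hv' := by
    have hu : Continuous fun x => S i x - S (i + 2) x := (hS i).sub (hS (i + 2))
    -- The value `v` may lie beyond the parameter of `pn n`, so it is truncated there; the
    -- truncations converge to `v`.
    choose x hx hxv using fun n => (h n).surj i (min v (S i (pn n) - S (i + 2) (pn n)))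
      (le_min hv (by linarith [(h n).le_center i _ ((h n).vertex_mem i),
        (h n).center_le' i ((h n).vertex_mem i)])) (min_le_right _ _)
    obtain ⟨z, -, φ, hφ, hz⟩ := hT.tendsto_subseq fun n => hKT n i (hx n)
    refine ⟨z, (hKC i).mem_of_mapClusterPt hx (hz.mapClusterPt.of_comp hφ.tendsto_atTop), ?_⟩
    have h1 := (hu.tendsto z).comp hz
    have h2 : Tendsto (fun n => min v (S i (pn n) - S (i + 2) (pn n))) atTop
        (𝓝 (min v (S i p - S (i + 2) p))) := tendsto_const_nhds.min ((hu.tendsto p).comp hp)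
    rw [min_eq_left hv'] at h2
    exact tendsto_nhds_unique h1 ((h2.comp hφ.tendsto_atTop).congr fun n => (hxv (φ n)).symm)
  vertex_le i x hx := by
    obtain ⟨y, hy, hyx⟩ := (hKC i).exists_tendsto x hx
    exact ge_of_tendsto' (((hS i).tendsto x).comp hyx) fun n => (h n).vertex_le i _ (hy n)
  le_vertex i x hx := by
    obtain ⟨y, hy, hyx⟩ := (hKC i).exists_tendsto x hx
    exact le_of_tendsto' (((hS (i + 2)).tendsto x).comp hyx) fun n => (h n).le_vertex i _ (hy n)

end Kuratowski

/-! ### Cartesian coordinates attached to the sides. -/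

noncomputable section

/-- The coordinate along the `i`-th side of the triangle. -/
def sideCoord (α : Fin 3 → TargetPlane) (i : Fin 3) (x : TargetPlane) : ℝ :=
  inner ℝ (sideDir α i) (x - α i)

/-- The coordinate along the inner normal of the `i`-th side of the triangle. -/
def sideHeight (α : Fin 3 → TargetPlane) (i : Fin 3) (x : TargetPlane) : ℝ :=
  inner ℝ (sideNormal α i) (x - α i)

variable {α : Fin 3 → TargetPlane}

theorem continuous_sideCoord (i : Fin 3) : Continuous (sideCoord α i) :=
  continuous_const.inner (continuous_id.sub continuous_const)

theorem continuous_sideHeight (i : Fin 3) : Continuous (sideHeight α i) :=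
  continuous_const.inner (continuous_id.sub continuous_const)

theorem continuous_sidePoint (i : Fin 3) : Continuous (sidePoint α i) := by
  unfold sidePoint
  fun_prop

theorem sideCoord_sidePoint (hα : AffineIndependent ℝ α) (i : Fin 3) (x : ℝ × ℝ) :
    sideCoord α i (sidePoint α i x) = x.1 := by
  simp only [sideCoord, sidePoint, add_assoc, add_sub_cancel_left, inner_add_right,
    inner_smul_right, inner_sideDir_self hα, inner_sideDir_sideNormal hα, mul_one, mul_zero,
    add_zero]

theorem sideHeight_sidePoint (hα : AffineIndependent ℝ α) (i : Fin 3) (x : ℝ × ℝ) :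
    sideHeight α i (sidePoint α i x) = x.2 := by
  have hc : inner ℝ (sideNormal α i) (sideDir α i) = 0 := by
    rw [real_inner_comm]; exact inner_sideDir_sideNormal hα i
  simp only [sideHeight, sidePoint, add_assoc, add_sub_cancel_left, inner_add_right,
    inner_smul_right, inner_sideNormal_self hα, hc, mul_one, mul_zero, zero_add]

/-- A vector of the plane orthogonal to two orthonormal vectors is zero. -/
theorem eq_zero_of_inner_eq_zero {d n y : TargetPlane} (hd : inner ℝ d d = (1 : ℝ))
    (hn : inner ℝ n n = (1 : ℝ)) (hdn : inner ℝ d n = (0 : ℝ)) (h1 : inner ℝ d y = (0 : ℝ))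
    (h2 : inner ℝ n y = (0 : ℝ)) : y = 0 := by
  simp only [PiLp.inner_apply, Fin.sum_univ_two, RCLike.inner_apply, conj_trivial] at *
  -- Lagrange's identity for the determinant of the frame; `e0` and `e1` are then Cramer's rule.
  have hdet : (d 0 * n 1 - d 1 * n 0) ^ 2 = 1 := by
    linear_combination (n 1 * n 1 + n 0 * n 0) * hd + hn - (n 0 * d 0 + n 1 * d 1) * hdn
  have hdet0 : d 0 * n 1 - d 1 * n 0 ≠ 0 := fun h => by
    rw [h] at hdet
    norm_num at hdet
  have e0 : (d 0 * n 1 - d 1 * n 0) * y 0 = 0 := by linear_combination n 1 * h1 - d 1 * h2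
  have e1 : (d 0 * n 1 - d 1 * n 0) * y 1 = 0 := by linear_combination d 0 * h2 - n 0 * h1
  ext j
  fin_cases j
  · exact (mul_eq_zero.1 e0).resolve_left hdet0
  · exact (mul_eq_zero.1 e1).resolve_left hdet0

theorem sidePoint_sideCoord_sideHeight (hα : AffineIndependent ℝ α) (i : Fin 3)
    (x : TargetPlane) : sidePoint α i (sideCoord α i x, sideHeight α i x) = x := by
  rw [← sub_eq_zero]
  have h1 := sideCoord_sidePoint hα i (sideCoord α i x, sideHeight α i x)
  have h2 := sideHeight_sidePoint hα i (sideCoord α i x, sideHeight α i x)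
  have hsub : ∀ y : TargetPlane, y - x = y - α i - (x - α i) := fun y => by abel
  refine eq_zero_of_inner_eq_zero (inner_sideDir_self hα i) (inner_sideNormal_self hα i)
    (inner_sideDir_sideNormal hα i) ?_ ?_
  · rw [hsub, inner_sub_right, sub_eq_zero]
    exact h1
  · rw [hsub, inner_sub_right, sub_eq_zero]
    exact h2

theorem sideLength_smul_sideDir (hα : AffineIndependent ℝ α) (i : Fin 3) :
    sideLength α i • sideDir α i = α (i + 1) - α i := by
  rw [sideDir, smul_smul, mul_inv_cancel₀ (sideLength_pos hα i).ne', one_smul]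

theorem sideLength_mul_inner_sideDir (hα : AffineIndependent ℝ α) (i : Fin 3) (y : TargetPlane) :
    sideLength α i * inner ℝ (sideDir α i) y = inner ℝ (α (i + 1) - α i) y := by
  rw [← sideLength_smul_sideDir hα, real_inner_smul_left]

theorem sidePoint_zero (i : Fin 3) : sidePoint α i (0, 0) = α i := by
  simp [sidePoint]

theorem sidePoint_sideLength (hα : AffineIndependent ℝ α) (i : Fin 3) :
    sidePoint α i (sideLength α i, 0) = α (i + 1) := by
  simp [sidePoint, sideLength_smul_sideDir hα]

theorem sideCoord_vertex (hα : AffineIndependent ℝ α) (i : Fin 3) : sideCoord α i (α i) = 0 := by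
  have := sideCoord_sidePoint hα i (0, 0)
  rwa [sidePoint_zero] at this

theorem sideHeight_vertex (hα : AffineIndependent ℝ α) (i : Fin 3) :
    sideHeight α i (α i) = 0 := by
  have := sideHeight_sidePoint hα i (0, 0)
  rwa [sidePoint_zero] at this

theorem sideCoord_next_vertex (hα : AffineIndependent ℝ α) (i : Fin 3) :
    sideCoord α i (α (i + 1)) = sideLength α i := by
  have := sideCoord_sidePoint hα i (sideLength α i, 0)
  rwa [sidePoint_sideLength hα] at this

theorem sideHeight_next_vertex (hα : AffineIndependent ℝ α) (i : Fin 3) :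
    sideHeight α i (α (i + 1)) = 0 := by
  have := sideHeight_sidePoint hα i (sideLength α i, 0)
  rwa [sidePoint_sideLength hα] at this

theorem sideNormal_eq (i : Fin 3) : sideNormal α i = ‖sideAltitude α i‖⁻¹ • ((α (i + 2) - α i) -
    (inner ℝ (sideDir α i) (α (i + 2) - α i) : ℝ) • sideDir α i) := rfl

/-- The edge vectors add up to zero, so the side coordinates weighted by the side lengths have
constant sum. Two edges span the plane, so two coordinates determine a point. -/
theorem isTriangleCoord_sideCoord (hα : AffineIndependent ℝ α) :
    ∃ c, IsTriangleCoord (sideLength α) c (sideCoord α) := by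
  have hrel : ∀ i x, sideLength α i * sideCoord α i x = inner ℝ (α (i + 1) - α i) (x - α i) :=
    fun i x => sideLength_mul_inner_sideDir hα i _
  have hsum : ∀ x, sideLength α 0 * sideCoord α 0 x + sideLength α 1 * sideCoord α 1 x +
      sideLength α 2 * sideCoord α 2 x = -(inner ℝ (α 1 - α 0) (α 0) + inner ℝ (α 2 - α 1) (α 1) +
        inner ℝ (α 0 - α 2) (α 2)) := by
    intro x
    rw [hrel, hrel, hrel]
    change inner ℝ (α 1 - α 0) (x - α 0) + inner ℝ (α 2 - α 1) (x - α 1) +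
      inner ℝ (α 0 - α 2) (x - α 2) = _
    simp only [inner_sub_left, inner_sub_right]
    ring
  refine ⟨_, sideLength_pos hα, continuous_sideCoord, fun i x => Eq.trans ?_ (hsum x),
    fun i x y h1 h2 => ?_⟩
  · fin_cases i
    · rfl
    · change sideLength α 1 * sideCoord α 1 x + sideLength α 2 * sideCoord α 2 x +
        sideLength α 0 * sideCoord α 0 x = _
      ring
    · change sideLength α 2 * sideCoord α 2 x + sideLength α 0 * sideCoord α 0 x +
        sideLength α 1 * sideCoord α 1 x = _
      ring
  · have hd : ∀ j, sideCoord α j x = sideCoord α j y → inner ℝ (sideDir α j) (x - y) = (0 : ℝ) := by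
      intro j hj
      have : x - y = (x - α j) - (y - α j) := by abel
      rw [this, inner_sub_right, sub_eq_zero]
      exact hj
    have h3 : inner ℝ (α (i + 2) - α i) (x - y) = (0 : ℝ) := by
      have e1 := sideLength_mul_inner_sideDir hα i (x - y)
      have e2 := sideLength_mul_inner_sideDir hα (i + 1) (x - y)
      rw [hd i h1, mul_zero] at e1
      rw [hd (i + 1) h2, mul_zero, add_assoc] at e2
      have : α (i + 2) - α i = (α (i + (1 + 1)) - α (i + 1)) + (α (i + 1) - α i) := by
        rw [sub_add_sub_cancel]
        rfl
      rw [this, inner_add_left, ← e1, ← e2, add_zero]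
    rw [← sub_eq_zero]
    refine eq_zero_of_inner_eq_zero (inner_sideDir_self hα i) (inner_sideNormal_self hα i)
      (inner_sideDir_sideNormal hα i) (hd i h1) ?_
    rw [sideNormal_eq, real_inner_smul_left, inner_sub_left, real_inner_smul_left, h3, hd i h1]
    simp

/-- The normal is a combination of the directions of sides `i` and `i + 2`. This transfers Lipschitz
control of the side coordinates to the height. -/
theorem exists_sideHeight_eq (hα : AffineIndependent ℝ α) (i : Fin 3) :
    ∃ A B d, ∀ x, sideHeight α i x = A * sideCoord α i x + B * sideCoord α (i + 2) x + d := by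
  refine ⟨-(‖sideAltitude α i‖⁻¹ * inner ℝ (sideDir α i) (α (i + 2) - α i)),
    -(‖sideAltitude α i‖⁻¹ * sideLength α (i + 2)),
    -(‖sideAltitude α i‖⁻¹ * inner ℝ (α i - α (i + 2)) (α (i + 2) - α i)), fun x => ?_⟩
  have h1 : sideLength α (i + 2) * sideCoord α (i + 2) x =
      inner ℝ (α i - α (i + 2)) (x - α (i + 2)) := by
    rw [sideCoord, sideLength_mul_inner_sideDir hα, add_assoc]
    simp
  have h2 : inner ℝ (α (i + 2) - α i) (x - α i) =
      -(inner ℝ (α i - α (i + 2)) (x - α (i + 2)) +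
        inner ℝ (α i - α (i + 2)) (α (i + 2) - α i) : ℝ) := by
    rw [← inner_add_right, sub_add_sub_cancel, ← inner_neg_left, neg_sub]
  have h3 : sideHeight α i x = ‖sideAltitude α i‖⁻¹ * (inner ℝ (α (i + 2) - α i) (x - α i) -
      inner ℝ (sideDir α i) (α (i + 2) - α i) * sideCoord α i x) := by
    rw [sideHeight, sideNormal_eq, real_inner_smul_left, inner_sub_left, real_inner_smul_left]
    rfl
  rw [h3, h2, ← h1]
  ring

/-! ### Fibres and connected pieces of a BV graph. -/

namespace IsBVGraphOver

variable {i : Fin 3} {φ : ℝ → ℝ} {G : Set TargetPlane}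

theorem mem_iff (hα : AffineIndependent ℝ α) (h : IsBVGraphOver α i φ G) (x : TargetPlane) :
    x ∈ G ↔ (sideCoord α i x, sideHeight α i x) ∈ generalizedGraph (sideLength α i) φ := by
  rw [h.2]
  constructor
  · rintro ⟨y, hy, rfl⟩
    rwa [sideCoord_sidePoint hα, sideHeight_sidePoint hα]
  · exact fun hx => ⟨_, hx, sidePoint_sideCoord_sideHeight hα i x⟩

theorem sideCoord_mem_Icc (hα : AffineIndependent ℝ α) (h : IsBVGraphOver α i φ G)
    {x : TargetPlane} (hx : x ∈ G) : sideCoord α i x ∈ Set.Icc 0 (sideLength α i) :=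
  ((h.mem_iff hα x).1 hx).1

theorem isClosed (hα : AffineIndependent ℝ α) (h : IsBVGraphOver α i φ G) : IsClosed G := by
  have : G = (fun x => (sideCoord α i x, sideHeight α i x)) ⁻¹'
      generalizedGraph (sideLength α i) φ := Set.ext fun x => h.mem_iff hα x
  rw [this]
  exact h.1.isClosed_generalizedGraph.preimage
    ((continuous_sideCoord i).prodMk (continuous_sideHeight i))

theorem sidePoint_mem (h : IsBVGraphOver α i φ G) {s : ℝ}
    (hs : s ∈ Set.Icc 0 (sideLength α i)) : sidePoint α i (s, φ s) ∈ G := by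
  rw [h.2]
  refine ⟨_, ⟨hs, ?_⟩, rfl⟩
  simp only
  rw [segment_eq_uIcc, h.1.eq_max s hs]
  exact ⟨min_le_max, le_rfl⟩

theorem inter_sideCoord_preimage (hα : AffineIndependent ℝ α) (h : IsBVGraphOver α i φ G) {s : ℝ}
    (hs : s ∈ Set.Icc 0 (sideLength α i)) : G ∩ sideCoord α i ⁻¹' {s} =
      (fun t => sidePoint α i (s, t)) ''
        segment ℝ (Function.leftLim φ s) (Function.rightLim φ s) := by
  ext x
  constructor
  · rintro ⟨hx, rfl⟩
    exact ⟨sideHeight α i x, ((h.mem_iff hα x).1 hx).2, sidePoint_sideCoord_sideHeight hα i x⟩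
  · rintro ⟨t, ht, rfl⟩
    refine ⟨?_, sideCoord_sidePoint hα i _⟩
    rw [h.2]
    exact ⟨_, ⟨hs, ht⟩, rfl⟩

/-- Every fibre is a segment: filling in the jumps is what makes the graph connected. -/
theorem isPreconnected_inter_sideCoord_preimage_Icc (hα : AffineIndependent ℝ α)
    (h : IsBVGraphOver α i φ G) (hG : IsCompact G) {a b : ℝ} (ha : 0 ≤ a)
    (hb : b ≤ sideLength α i) : IsPreconnected (G ∩ sideCoord α i ⁻¹' Set.Icc a b) := by
  refine hG.isPreconnected_inter_preimage_Icc (continuous_sideCoord i) (fun s hs => ?_)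
    fun s hs => ?_
  · rw [h.inter_sideCoord_preimage hα ⟨ha.trans hs.1, hs.2.trans hb⟩]
    exact ⟨_, Set.mem_image_of_mem _ (left_mem_segment ℝ _ _)⟩
  · rw [h.inter_sideCoord_preimage hα ⟨ha.trans hs.1, hs.2.trans hb⟩]
    exact (convex_segment _ _).isPreconnected.image _
      ((continuous_sidePoint i).comp (continuous_const.prodMk continuous_id)).continuousOn

/-- All but countably many fibres of a generalized graph have at most one point. -/
theorem countable_not_subsingleton (hα : AffineIndependent ℝ α) (h : IsBVGraphOver α i φ G) :
    {s | ¬ (G ∩ sideCoord α i ⁻¹' {s}).Subsingleton}.Countable := by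
  refine h.1.countable_leftLim_ne_rightLim.mono fun s hs => ?_
  rw [Set.mem_ofPred_eq] at hs ⊢
  refine fun heq => hs ?_
  by_cases hsI : s ∈ Set.Icc 0 (sideLength α i)
  · rw [h.inter_sideCoord_preimage hα hsI, heq, segment_same, Set.image_singleton]
    exact Set.subsingleton_singleton
  · rintro x ⟨hx, rfl⟩
    exact absurd (h.sideCoord_mem_Icc hα hx) hsI

end IsBVGraphOver

theorem isCompact_targetTriangle : IsCompact (targetTriangle α) :=
  (Set.finite_range α).isCompact_convexHull ℝ

/-! ### Connections are monotone triods. -/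

namespace BVConnection

variable (Γ : BVConnection α)

theorem union_subset (i : Fin 3) : Γ.branch i ∪ Γ.branch (i + 1) ⊆ targetTriangle α :=
  Set.union_subset (Γ.branch_subset i) (Γ.branch_subset (i + 1))

theorem isCompact_union (hα : AffineIndependent ℝ α) (i : Fin 3) :
    IsCompact (Γ.branch i ∪ Γ.branch (i + 1)) :=
  isCompact_targetTriangle.of_isClosed_subset ((Γ.graphFun_spec i).isClosed hα) (Γ.union_subset i)

/-- Connected pieces of each graph can pass from one branch to the other only through `p`, which
separates the branches along the side. Playing the graphs over the two sides adjacent to a vertex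
against each other gives the monotonicity. -/
theorem isMonotoneTriod (hα : AffineIndependent ℝ α) {p : TargetPlane}
    (hp : ∀ i, Γ.branch i ∩ Γ.branch (i + 1) = {p}) :
    IsMonotoneTriod α (sideCoord α) Γ.branch p := by
  have hspec : ∀ i, IsBVGraphOver α i (Γ.graphFun i) (Γ.branch i ∪ Γ.branch (i + 1)) :=
    Γ.graphFun_spec
  have hspec' : ∀ i, IsBVGraphOver α (i + 2) (Γ.graphFun (i + 2))
      (Γ.branch (i + 2) ∪ Γ.branch i) := fun i => by
    have := hspec (i + 2)
    rwa [add_assoc, show (2 : Fin 3) + 1 = 0 from rfl, add_zero] at this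
  have hp' : ∀ i, Γ.branch (i + 2) ∩ Γ.branch i = {p} := fun i => by
    have := hp (i + 2)
    rwa [add_assoc, show (2 : Fin 3) + 1 = 0 from rfl, add_zero] at this
  have hmem : ∀ i, p ∈ Γ.branch i := fun i => by
    have : p ∈ Γ.branch i ∩ Γ.branch (i + 1) := hp i ▸ Set.mem_singleton p
    exact this.1
  -- A branch is the intersection of the two graphs containing it, hence closed.
  have hinter : ∀ i, (Γ.branch i ∪ Γ.branch (i + 1)) ∩ (Γ.branch (i + 2) ∪ Γ.branch i) =
      Γ.branch i := by
    intro i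
    refine Set.Subset.antisymm ?_ fun x hx => ⟨Or.inl hx, Or.inr hx⟩
    rintro x ⟨hx | hx, hx' | hx'⟩
    · exact hx
    · exact hx
    · have : x ∈ Γ.branch (i + 1) ∩ Γ.branch (i + 1 + 1) := ⟨hx, by rwa [add_assoc]⟩
      rw [hp] at this
      exact Set.mem_singleton_iff.1 this ▸ hmem i
    · exact hx'
  have hclosed : ∀ i, IsClosed (Γ.branch i) := fun i => by
    rw [← hinter i]
    exact ((hspec i).isClosed hα).inter ((hspec' i).isClosed hα)
  have hcompact : ∀ i, IsCompact (Γ.branch i) := fun i =>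
    isCompact_targetTriangle.of_isClosed_subset (hclosed i) (Γ.branch_subset i)
  have hGc : ∀ i, IsCompact (Γ.branch i ∪ Γ.branch (i + 1)) := fun i => Γ.isCompact_union hα i
  have hGc' : ∀ i, IsCompact (Γ.branch (i + 2) ∪ Γ.branch i) := fun i =>
    (hcompact _).union (hcompact _)
  -- If `x` lay beyond `p`, the part of the graph from `x` onwards would be connected, avoid `p`,
  -- and contain both `x` and the vertex of the other branch.
  have hle : ∀ i, ∀ x ∈ Γ.branch i, sideCoord α i x ≤ sideCoord α i p := by
    intro i x hx
    by_contra! hlt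
    have hxI := (hspec i).sideCoord_mem_Icc hα (Or.inl hx)
    exact ((hspec i).isPreconnected_inter_sideCoord_preimage_Icc hα (hGc i) hxI.1
      le_rfl).notMem_of_inter_eq_singleton (hclosed i) (hclosed (i + 1)) (hp i)
      Set.inter_subset_left (fun h => not_le.2 hlt h.2.1) (x := x) (y := α (i + 1))
      ⟨Or.inl hx, le_rfl, hxI.2⟩
      ⟨Or.inr (Γ.vertex_mem _), by
        rw [Set.mem_preimage, sideCoord_next_vertex hα]
        exact ⟨hxI.2, le_rfl⟩⟩
      (Γ.vertex_mem _) hx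
  have hge : ∀ i, ∀ x ∈ Γ.branch (i + 1), sideCoord α i p ≤ sideCoord α i x := by
    intro i x hx
    by_contra! hlt
    have hxI := (hspec i).sideCoord_mem_Icc hα (Or.inr hx)
    exact ((hspec i).isPreconnected_inter_sideCoord_preimage_Icc hα (hGc i) le_rfl
      hxI.2).notMem_of_inter_eq_singleton (hclosed (i + 1)) (hclosed i)
      ((Set.inter_comm _ _).trans (hp i))
      (Set.inter_subset_left.trans (Set.union_comm _ _).subset) (fun h => not_le.2 hlt h.2.2)
      (x := x) (y := α i) ⟨Or.inr hx, hxI.1, le_rfl⟩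
      ⟨Or.inl (Γ.vertex_mem _), by
        rw [Set.mem_preimage, sideCoord_vertex hα]
        exact ⟨le_rfl, hxI.1⟩⟩
      (Γ.vertex_mem _) hx
  have hge' : ∀ i, ∀ x ∈ Γ.branch i, sideCoord α (i + 2) p ≤ sideCoord α (i + 2) x :=
    fun i x hx => hge (i + 2) x (by
      rwa [add_assoc, show (2 : Fin 3) + 1 = 0 from rfl, add_zero])
  have hvertex : ∀ i, sideCoord α (i + 2) (α i) = sideLength α (i + 2) := fun i => by
    have := sideCoord_next_vertex hα (i + 2)
    rwa [add_assoc, show (2 : Fin 3) + 1 = 0 from rfl, add_zero] at this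
  have hconn : ∀ i, IsPreconnected (Γ.branch i) := by
    intro i
    refine IsPreconnected.left_of_union_of_inter_eq_singleton (hclosed i) (hclosed (i + 1)) (hp i) ?_
    have := (hspec i).isPreconnected_inter_sideCoord_preimage_Icc hα (hGc i) le_rfl le_rfl
    have hsub : Γ.branch i ∪ Γ.branch (i + 1) ⊆ sideCoord α i ⁻¹' Set.Icc 0 (sideLength α i) :=
      fun x hx => (hspec i).sideCoord_mem_Icc hα hx
    rwa [Set.inter_eq_left.2 hsub] at this
  refine ⟨hcompact, Γ.vertex_mem, hmem, hle, hge, ?_, ?_, ?_, ?_⟩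
  · intro i x hx y hy hxy
    by_contra! hlt
    -- Only countably many levels carry a jump, so one strictly between `x` and `y` has at most one
    -- point over it.
    obtain ⟨s, ⟨hxs, hsy⟩, hs⟩ : ∃ s ∈ Set.Ioo (sideCoord α i x) (sideCoord α i y),
        ((Γ.branch i ∪ Γ.branch (i + 1)) ∩ sideCoord α i ⁻¹' {s}).Subsingleton := by
      by_contra hcon
      refine not_le.2 hxy (Cardinal.Real.Ioo_countable_iff.1
        (((hspec i).countable_not_subsingleton hα).mono fun s hs => ?_))
      exact fun hsub => hcon ⟨s, hs, hsub⟩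
    have hp0 : sideCoord α i (α i) ≤ sideCoord α i x := by
      rw [sideCoord_vertex hα]
      exact ((hspec i).sideCoord_mem_Icc hα (Or.inl hx)).1
    have hxI := (hspec' i).sideCoord_mem_Icc hα (Or.inr hx)
    have hyI := (hspec' i).sideCoord_mem_Icc hα (Or.inr hy)
    have hpI := (hspec' i).sideCoord_mem_Icc hα (Or.inr (hmem i))
    -- Every intermediate value of the second coordinate is attained over the level `s`.
    have key : ∀ D ∈ Set.Ioo (sideCoord α (i + 2) x) (sideCoord α (i + 2) y),
        ∃ z ∈ Γ.branch i, sideCoord α i z = s ∧ sideCoord α (i + 2) z = D := by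
      intro D hD
      have hpD : sideCoord α (i + 2) p < D := (hge' i x hx).trans_lt hD.1
      -- The part with second coordinate at least `D` joins `α i` to `y` inside branch `i`, and the
      -- part of the branch with second coordinate at most `D` joins `x` to `p`. Both cross level
      -- `s`, necessarily at the same point, so its second coordinate is `D`.
      have hK1 := (hspec' i).isPreconnected_inter_sideCoord_preimage_Icc hα (hGc' i)
        (hpI.1.trans hpD.le) le_rfl
      obtain ⟨z, hz, hzs⟩ := hK1.intermediate_value (a := α i) (b := y)
        ⟨Or.inr (Γ.vertex_mem i), by
          rw [Set.mem_preimage, hvertex]; exact ⟨hD.2.le.trans hyI.2, le_rfl⟩⟩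
        ⟨Or.inr hy, hD.2.le, hyI.2⟩ (continuous_sideCoord i).continuousOn
        ⟨hp0.trans hxs.le, hsy.le⟩
      have hzb : z ∈ Γ.branch i := hz.1.resolve_left fun hz' =>
        not_lt.2 (hle (i + 2) z hz') (hpD.trans_le hz.2.1)
      have hK2 : IsPreconnected (Γ.branch i ∩ sideCoord α (i + 2) ⁻¹' Set.Iic D) := by
        refine IsPreconnected.left_of_union_of_inter_eq_singleton (B := Γ.branch (i + 2)) (p := p)
          ((hclosed i).inter (isClosed_Iic.preimage (continuous_sideCoord _))) (hclosed _) ?_ ?_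
        · refine Set.Subset.antisymm (fun x hx => ?_)
            (Set.singleton_subset_iff.2 ⟨⟨hmem i, hpD.le⟩, hmem _⟩)
          rw [← hp' i]
          exact ⟨hx.2, hx.1.1⟩
        · have := (hspec' i).isPreconnected_inter_sideCoord_preimage_Icc hα (hGc' i) le_rfl
            (hD.2.le.trans hyI.2)
          convert this using 1
          ext x
          constructor
          · rintro (hx | hx)
            · exact ⟨Or.inr hx.1, ((hspec' i).sideCoord_mem_Icc hα (Or.inr hx.1)).1, hx.2⟩
            · exact ⟨Or.inl hx, ((hspec' i).sideCoord_mem_Icc hα (Or.inl hx)).1,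
                (hle _ x hx).trans hpD.le⟩
          · rintro ⟨hx | hx, hx'⟩
            · exact Or.inr hx
            · exact Or.inl ⟨hx, hx'.2⟩
      obtain ⟨z', hz', hzs'⟩ := hK2.intermediate_value (a := x) (b := p)
        ⟨hx, hD.1.le⟩ ⟨hmem i, hpD.le⟩ (continuous_sideCoord i).continuousOn
        ⟨hxs.le, hsy.le.trans (hle i y hy)⟩
      have hzz : z = z' := hs ⟨Or.inl hzb, hzs⟩ ⟨Or.inl hz'.1, hzs'⟩
      exact ⟨z, hzb, hzs, le_antisymm (hzz ▸ hz'.2) hz.2.1⟩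
    obtain ⟨D, hD1, hD2⟩ := exists_between hlt
    obtain ⟨D', hD1', hD2'⟩ := exists_between hD2
    obtain ⟨z, hz, hzs, hzD⟩ := key D ⟨hD1, hD2⟩
    obtain ⟨z', hz', hzs', hzD'⟩ := key D' ⟨hD1.trans hD1', hD2'⟩
    have : z = z' := hs ⟨Or.inl hz, hzs⟩ ⟨Or.inl hz', hzs'⟩
    rw [this, hzD'] at hzD
    exact hD1'.ne' hzD
  · intro i v hv hv'
    exact (hconn i).intermediate_value (Γ.vertex_mem i) (hmem i)
      ((continuous_sideCoord i).sub (continuous_sideCoord (i + 2))).continuousOn ⟨hv, hv'⟩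
  · intro i x hx
    rw [sideCoord_vertex hα]
    exact ((hspec i).sideCoord_mem_Icc hα (Or.inl hx)).1
  · intro i x hx
    rw [hvertex]
    exact ((hspec' i).sideCoord_mem_Icc hα (Or.inr hx)).2

end BVConnection

end

/-! ### The limit connection and convergence in `L¹`. -/

variable {α : Fin 3 → TargetPlane}

/-- Two consecutive branches of a monotone triod that meet in one point form a BV graph over the
side joining their vertices. -/
theorem IsMonotoneTriod.exists_isBVGraphOver (hα : AffineIndependent ℝ α)
    {C : Fin 3 → Set TargetPlane} {q : TargetPlane}
    (h : IsMonotoneTriod α (sideCoord α) C q) {i : Fin 3} (hq : C i ∩ C (i + 1) = {q}) :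
    ∃ φ, IsBVGraphOver α i φ (C i ∪ C (i + 1)) := by
  obtain ⟨c, hS⟩ := isTriangleCoord_sideCoord hα
  obtain ⟨A, B, d, hT⟩ := exists_sideHeight_eq hα i
  obtain ⟨φ, hφ, hG⟩ := h.exists_isGoodBV hS hq hT (sideCoord_vertex hα i)
    (sideCoord_next_vertex hα i) (sideHeight_vertex hα i) (sideHeight_next_vertex hα i)
  refine ⟨φ, hφ, ?_⟩
  rw [hG, Set.image_image]
  simp only [sidePoint_sideCoord_sideHeight hα, Set.image_id']

/-- If BV graphs in a compact set converge in the sense of Kuratowski to a set that agrees with a BV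
graph over all but one point of the side, then their functions converge in `L¹`. -/
theorem IsBVGraphOver.tendsto_eLpNorm (hα : AffineIndependent ℝ α) {i : Fin 3} {T : Set TargetPlane}
    (hT : IsCompact T) {φn : ℕ → ℝ → ℝ} {φ : ℝ → ℝ} {K : ℕ → Set TargetPlane}
    {C G : Set TargetPlane} (hn : ∀ n, IsBVGraphOver α i (φn n) (K n)) (hKT : ∀ n, K n ⊆ T)
    (hKC : KuratowskiTendsto K C) (hφ : IsBVGraphOver α i φ G) (hGT : G ⊆ T) {s₀ : ℝ}
    (hCG : ∀ x ∈ C, sideCoord α i x ≠ s₀ → x ∈ G) :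
    Tendsto (fun n => eLpNorm (φn n - φ) 1 (volume.restrict (Set.Icc 0 (sideLength α i))))
      atTop (𝓝 0) := by
  obtain ⟨M, hM⟩ := hT.exists_bound_of_continuousOn (continuous_sideHeight i).continuousOn
  have hbound : ∀ {ψ : ℝ → ℝ} {H : Set TargetPlane}, IsBVGraphOver α i ψ H → H ⊆ T →
      ∀ s ∈ Set.Icc 0 (sideLength α i), ‖ψ s‖ ≤ M := fun {ψ H} h hH s hs => by
    have := hM _ (hH (h.sidePoint_mem hs))
    rwa [sideHeight_sidePoint hα] at this
  have hpt : ∀ᵐ s ∂volume.restrict (Set.Icc 0 (sideLength α i)),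
      Tendsto (fun n => φn n s) atTop (𝓝 (φ s)) := by
    rw [ae_restrict_iff' measurableSet_Icc]
    filter_upwards [(hφ.countable_not_subsingleton hα).ae_notMem volume,
      (Set.countable_singleton s₀).ae_notMem volume] with s hs hs0 hsI
    rw [not_not] at hs
    -- Every cluster point lies in `C` over `s`, hence in the one-point fibre of `G`; compactness of
    -- `T` turns this into convergence.
    have key : Tendsto (fun n => sidePoint α i (s, φn n s)) atTop (𝓝 (sidePoint α i (s, φ s))) := by
      refine (hT.inter_right (isClosed_singleton.preimage
        (continuous_sideCoord i))).tendsto_nhds_of_unique_mapClusterPt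
        (s := T ∩ sideCoord α i ⁻¹' {s}) (Eventually.of_forall fun n =>
          ⟨hKT n ((hn n).sidePoint_mem hsI), sideCoord_sidePoint hα i _⟩) fun z hz hzc => ?_
      have hzC := hKC.mem_of_mapClusterPt (fun n => (hn n).sidePoint_mem hsI) hzc
      have hzs : sideCoord α i z = s := hz.2
      exact hs ⟨hCG z hzC (hzs.trans_ne hs0), hzs⟩
        ⟨hφ.sidePoint_mem hsI, sideCoord_sidePoint hα i _⟩
    have := ((continuous_sideHeight (α := α) i).tendsto _).comp key
    simp only [sideHeight_sidePoint hα] at this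
    exact this.congr fun n => sideHeight_sidePoint hα i _
  simp only [eLpNorm_one_eq_lintegral_enorm]
  have hlim : Tendsto (fun n => ∫⁻ s, ‖(φn n - φ) s‖ₑ
      ∂volume.restrict (Set.Icc 0 (sideLength α i))) atTop
      (𝓝 (∫⁻ _, 0 ∂volume.restrict (Set.Icc 0 (sideLength α i)))) := by
    refine tendsto_lintegral_of_dominated_convergence (fun _ => ENNReal.ofReal (M + M))
      (fun n => ((hn n).1.measurable.sub hφ.1.measurable).enorm) (fun n => ?_) ?_ ?_
    · rw [EventuallyLE, ae_restrict_iff' measurableSet_Icc]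
      refine Eventually.of_forall fun s hs => ?_
      rw [← ofReal_norm]
      exact ENNReal.ofReal_le_ofReal ((norm_sub_le _ _).trans
        (add_le_add (hbound (hn n) (hKT n) s hs) (hbound hφ hGT s hs)))
    · rw [lintegral_const]
      exact ENNReal.mul_ne_top ENNReal.ofReal_ne_top (measure_ne_top _ _)
    · filter_upwards [hpt] with s hs
      have h1 := (hs.sub_const (φ s)).enorm
      rwa [sub_self, enorm_zero] at h1
  rwa [lintegral_zero] at hlim

/-- Sequential compactness of the space of BV graph-type connections in a nondegenerate triangle. -/
theorem theorem5p7 (α : Fin 3 → TargetPlane) (hα : AffineIndependent ℝ α)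
    (Γn : ℕ → BVConnection α) :
    ∃ (k : ℕ → ℕ) (Γ : BVConnection α), StrictMono k ∧ ConvergesInX (fun n => Γn (k n)) Γ := by
  have hT : IsCompact (targetTriangle α) := isCompact_targetTriangle
  choose p hpT hp using fun n => (Γn n).exists_triplePoint
  have htriod := fun n => (Γn n).isMonotoneTriod hα (hp n)
  obtain ⟨p', -, k₁, hk₁, hp'⟩ := hT.tendsto_subseq hpT
  obtain ⟨k₂, C, hk₂, hC⟩ := exists_kuratowskiTendsto_subseq hT
    (K := fun n i => (Γn (k₁ n)).branch i) (fun n i => (htriod _).isCompact i)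
    (fun n i => ⟨_, (htriod _).vertex_mem i⟩) fun n i => (Γn _).branch_subset i
  have hlimit : IsMonotoneTriod α (sideCoord α) C p' :=
    IsMonotoneTriod.of_kuratowskiTendsto hT continuous_sideCoord
      (fun n => htriod (k₁ (k₂ n))) (fun n i => (Γn _).branch_subset i) (fun i => (hC i).1)
      (fun i => (hC i).2.2) (hp'.comp hk₂.tendsto_atTop)
  obtain ⟨c, hS⟩ := isTriangleCoord_sideCoord hα
  -- The corrected triple point `q` may differ from `p'`; the exceptional level of each coordinate
  -- is still the one through `p'`.
  obtain ⟨C', q, htriod', hq, hsub, hagree⟩ := hlimit.exists_inter_eq_singleton hS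
  have hC'T : ∀ i, C' i ⊆ targetTriangle α := fun i =>
    (hsub i).trans (Set.iUnion_subset fun j => (hC j).2.1)
  let Γ : BVConnection α :=
    { branch := C'
      branch_subset := hC'T
      exists_triplePoint := ⟨q, hC'T 0 (htriod'.center_mem 0), hq⟩
      vertex_mem := htriod'.vertex_mem
      exists_graph := fun i => htriod'.exists_isBVGraphOver hα (hq i) }
  refine ⟨k₁ ∘ k₂, Γ, hk₁.comp hk₂, fun i => ?_⟩
  exact IsBVGraphOver.tendsto_eLpNorm hα hT (fun n => (Γn (k₁ (k₂ n))).graphFun_spec i)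
    (fun n => (Γn _).union_subset i) ((hC i).2.2.union (hC (i + 1)).2.2) (Γ.graphFun_spec i)
    (Γ.union_subset i) (s₀ := sideCoord α i p') fun x hx hxp => (hagree i x hxp).2 hx
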